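/- Let $\mathbb F$ be an algebraically closed field of characteristic $2$, and let $\beta$ be an element of the monoid $\mathsf{Br}_n^+$ of positive braids on $n$ strands (generators $s_1,\dots,s_{n-1}$; relations $s_is_j=s_js_i$ for $|i-j|\ge 2$ and $s_is_{i+1}s_i=s_{i+1}s_is_{i+1}$). For a word ${\bf i}=(i_1,\dots,i_l)$ of $\beta$ let $\Lambda_\beta$ be the Legendrian rainbow closure of ${\bf i}$, with one marked point next to each of its $n$ right cusps, and let $\mathcal A(\Lambda_\beta)$ be its Chekanov–Eliashberg dga over $\mathbb Z/2$: it is generated by the degree $0$ Reeb chords $b_1,\dots,b_l$ (crossings of the braid), the degree $1$ Reeb chords $a_1,\dots,a_n$ (right cusps) and the invertible formal variables $t_1^{\pm1},\dots,t_n^{\pm1}$ (marked points), all non-commuting, and its differential counts immersed disks with convex corners, exactly one of them positive, in the Lagrangian diagram that Ng's resolution produces from the front. The augmentation variety $\mathrm{Aug}(\Lambda_\beta)=\mathrm{Spec}\,H_0(\mathcal A(\Lambda_\beta)^c,\mathbb F)$ is the affine $\mathbb F$-scheme whose points over a commutative $\mathbb F$-algebra $R$ are the augmentations $\mathcal A(\Lambda_\beta)\to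 R$; the functions $b_1,\dots,b_l$ on it are the Reeb coordinates. Let $\mathsf G=\mathrm{SL}_n$, let $\mathsf B_\pm$ be the subgroups of upper and lower triangular matrices, and let $\mathsf U_-$ be the group of lower unitriangular matrices. The half-decorated double Bott–Samelson cell $\mathrm{Conf}^e_\beta(\mathcal C)$ is the moduli space of $\mathsf G$-orbits of collections $(\mathsf A;\mathsf B^0,\dots,\mathsf B^l)$ with $\mathsf A\in\mathsf U_-\backslash\mathsf G$ and $\mathsf B^k\in\mathsf G/\mathsf B_+$, such that $\mathsf B^{k-1}$ and $\mathsf B^k$ are in relative position $s_{i_k}$ (that is, $x^{-1}y\in\mathsf B_+s_{i_k}\mathsf B_+$ if $\mathsf B^{k-1}=x\mathsf B_+$ and $\mathsf B^k=y\mathsf B_+$) for $1\le k\le l$, and $\mathsf A$ is in general position with both $\mathsf B^0$ and $\mathsf B^l$ (where $\mathsf U_-x$ and $y\mathsf B_+$ are in general position if $xy\in\mathsf B_-\mathsf B_+$). A point has affine coordinates $(q_1,\dots,q_l)$ if it is the orbit of the collection with $\mathsf A=\mathsf U_-$ and $\mathsf B^k=R_{i_1}(q_1)\cdots R_{i_k}(q_k)\mathsf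 B_+$ for $0\le k\le l$, where $R_i(q)$ is the identity matrix with the block in rows and columns $i,i+1$ replaced by $\begin{pmatrix}q&-1\\1&0\end{pmatrix}$. **Theorem.** For every word ${\bf i}$ of $\beta$ there is an isomorphism of $\mathbb F$-varieties (that is, an isomorphism of functors of points on commutative $\mathbb F$-algebras) $$\gamma_{\bf i}:\ \mathrm{Aug}(\Lambda_\beta)\ \xrightarrow{\ \cong\ }\ \mathrm{Conf}^e_\beta(\mathcal C)$$ onto the base change of $\mathrm{Conf}^e_\beta(\mathcal C)$ to $\mathbb F$, which identifies the coordinates: for every commutative $\mathbb F$-algebra $R$ and every $R$-point $\varepsilon$ of $\mathrm{Aug}(\Lambda_\beta)$, a tuple $(q_1,\dots,q_l)\in R^l$ is a tuple of affine coordinates of $\gamma_{\bf i}(\varepsilon)$ if and only if $q_k=\varepsilon(b_k)$ for all $k$. Moreover these isomorphisms do not depend on the choice of the word. Any two words ${\bf i},{\bf i}'$ of $\beta$ are connected by a sequence of braid moves. Every such sequence induces isomorphisms $\varphi$ between the augmentation varieties and $\psi$ between the double Bott–Samelson cells formed with ${\bf i}$ and with ${\bf i}'$, and $\psi\circ\gamma_{\bf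 i}=\gamma_{{\bf i}'}\circ\varphi$. Here $\varphi$ is the composite of the isomorphisms of the single moves that fix all $t_j$ and all Reeb coordinates not involved in the move, and that exchange the two Reeb coordinates involved in a move $s_is_j\to s_js_i$ with $|i-j|\ge2$, respectively send the three Reeb coordinates involved in a move $s_is_js_i\to s_js_is_j$ with $|i-j|=1$ from $(b_k,b_{k+1},b_{k+2})$ to $(b_{k+2},\,b_{k+1}+b_kb_{k+2},\,b_k)$; and $\psi$ is the composite of the isomorphisms of the single moves that keep $\mathsf A$ and all flags $\mathsf B^k$ except those strictly inside the part of the chain that the move affects, which are replaced by the unique flags with the required relative positions. -/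

import Mathlib

open CategoryTheory

universe u

/-! ## Positive braids, their words and braid moves -/

/-- The defining relations of the monoid of positive braids on `n` strands, with generators
`s_0, …, s_{n-2}` (the generator `s_i` crosses the adjacent strands `i` and `i + 1`). -/
inductive BraidRel (n : ℕ) : FreeMonoid (Fin (n - 1)) → FreeMonoid (Fin (n - 1)) → Prop
  | comm (i j : Fin (n - 1)) (h : (i : ℕ) + 2 ≤ j) :
      BraidRel n (.of i * .of j) (.of j * .of i)
  | braid (i j : Fin (n - 1)) (h : (i : ℕ) + 1 = j) :
      BraidRel n (.of i * .of j * .of i) (.of j * .of i * .of j)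

/-- The monoid `Br_n⁺` of positive braids on `n` strands. -/
abbrev PosBraid (n : ℕ) : Type := PresentedMonoid (BraidRel n)

/-- A braid word: a finite sequence of generators. -/
abbrev BraidWord (n : ℕ) : Type := List (Fin (n - 1))

/-- The positive braid presented by a word. -/
def BraidWord.toBraid {n : ℕ} (w : BraidWord n) : PosBraid n :=
  PresentedMonoid.mk (BraidRel n) (FreeMonoid.ofList w)

/-- The words of a positive braid `β`. -/
abbrev PosBraid.Word {n : ℕ} (β : PosBraid n) : Type := {w : BraidWord n // w.toBraid = β}

/-- A single braid move between two words: either the exchange of two neighbouring letters that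
commute, or `… s_i s_j s_i … ↝ … s_j s_i s_j …` with `|i - j| = 1`. -/
inductive BraidMove {n : ℕ} : BraidWord n → BraidWord n → Type
  | comm (a z : BraidWord n) (i j : Fin (n - 1)) (h : (i : ℕ) + 2 ≤ j ∨ (j : ℕ) + 2 ≤ i) :
      BraidMove (a ++ i :: j :: z) (a ++ j :: i :: z)
  | braid (a z : BraidWord n) (i j : Fin (n - 1)) (h : (i : ℕ) + 1 = j ∨ (j : ℕ) + 1 = i) :
      BraidMove (a ++ i :: j :: i :: z) (a ++ j :: i :: j :: z)

/-- A finite sequence of braid moves from one word to another. -/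
inductive MovePath {n : ℕ} : BraidWord n → BraidWord n → Type
  | nil (w : BraidWord n) : MovePath w w
  | cons {w w' w'' : BraidWord n} (m : BraidMove w w') (p : MovePath w' w'') : MovePath w w''

/-! ## Lagrangian diagrams of Legendrian links, sliced by vertical lines

A Lagrangian projection in general position with respect to the horizontal coordinate is recorded
as a list of events, from left to right.  Between two events the diagram consists of horizontal
strands, numbered `0, 1, 2, …` from the top to the bottom.  In the diagrams that come from a
front by Ng's resolution, at every crossing the strand of negative slope is the overstrand;
hence the left and right quadrants of a crossing carry the Reeb sign `+`, and the top and bottom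
quadrants carry the Reeb sign `-`.  A right cusp of the front is resolved into a crossing followed
by a right cap. -/

/-- An event of a Lagrangian diagram; `C` is the type of names of Reeb chords (crossings), `T` the
type of names of marked points.
* `leftCap p`: two new strands `p` and `p + 1` are born, joined by a smooth left extremum.
* `crossing p c`: the strands `p` and `p + 1` cross, the crossing being the Reeb chord `c`.
* `rightCap p t`: the strands `p` and `p + 1` end, joined by a smooth right extremum, which
  carries the marked point `t` and on which the link is oriented downwards. -/
inductive Event (C T : Type) : Type
  | leftCap (p : ℕ)
  | crossing (p : ℕ) (c : C)
  | rightCap (p : ℕ) (t : T)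

/-- A Lagrangian diagram, as the list of its events from left to right. -/
abbrev Diagram (C T : Type) : Type := List (Event C T)

/-- The position of the strand `i` after two strands are inserted at positions `p` and `p + 1`. -/
def skipPair (p i : ℕ) : ℕ := if i < p then i else i + 2

/-- `StrandStep e i i'`: the strand `i` to the left of the event `e` continues as
the strand `i'` to the right of `e`. -/
inductive StrandStep {C T : Type} : Event C T → ℕ → ℕ → Prop
  | leftCap (p i : ℕ) : StrandStep (.leftCap p) i (skipPair p i)
  | rightCap (p i : ℕ) (t : T) : StrandStep (.rightCap p t) (skipPair p i) i
  | away (p i : ℕ) (c : C) (h : i ≠ p) (h' : i ≠ p + 1) : StrandStep (.crossing p c) i i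
  | down (p : ℕ) (c : C) : StrandStep (.crossing p c) p (p + 1)
  | up (p : ℕ) (c : C) : StrandStep (.crossing p c) (p + 1) p

/-- `UpperEdge e i i' o`: the upper boundary of a disk (the disk lies below it) runs along the
strand `i` to the left of the event `e` and along `i'` to the right of it.  Either it follows the
strand (`o = none`) or it has a convex corner at the bottom quadrant of a crossing `c`
(`o = some c`). -/
inductive UpperEdge {C T : Type} : Event C T → ℕ → ℕ → Option C → Prop
  | follow {e : Event C T} {i i' : ℕ} (h : StrandStep e i i') : UpperEdge e i i' none
  | corner (p : ℕ) (c : C) : UpperEdge (.crossing p c) (p + 1) (p + 1) (some c)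

/-- The same for the lower boundary of a disk (the disk lies above it); its convex corners occupy
the top quadrant of a crossing. -/
inductive LowerEdge {C T : Type} : Event C T → ℕ → ℕ → Option C → Prop
  | follow {e : Event C T} {i i' : ℕ} (h : StrandStep e i i') : LowerEdge e i i' none
  | corner (p : ℕ) (c : C) : LowerEdge (.crossing p c) p p (some c)

/-- The two sides of a vertical cut. -/
inductive Side : Type
  | left
  | right

/-! ### Immersed disks

Let `u` be an orientation preserving immersion of a disk into the plane, with boundary on the
diagram and with convex corners only.  The horizontal coordinate composed with `u` has no critical
point in the interior of the disk, so the components of the preimages of vertical lines are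
intervals, each mapped injectively onto a segment `[i, j]` between two strands `i < j` (the strand
`i`, on top, carries the upper end).  The interior of such a segment may well meet further strands.
Since the disk is simply connected, each such interval cuts it into two pieces.  At an event, an
interval either continues, or is born, or dies, or splits in two, or two intervals merge.  So the
pieces are generated by the rules below, and an immersed disk up to reparametrization is the same
thing as a derivation by these rules.

`Piece D s x i j` is the type of pieces that lie on the side `s` of the vertical line just before
the event number `x` and that are bounded on that line by one segment `[i, j]`, and all of whose
corners are at negative quadrants. -/
inductive Piece {C T : Type} (D : Diagram C T) : Side → ℕ → ℕ → ℕ → Type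
  /-- The disk starts inside a left cap. -/
  | birth {x p : ℕ} (h : D[x]? = some (.leftCap p)) : Piece D .left (x + 1) p (p + 1)
  /-- The disk ends inside a right cap. -/
  | death {x p : ℕ} {t : T} (h : D[x]? = some (.rightCap p t)) : Piece D .right x p (p + 1)
  /-- The segment continues from left to right. -/
  | stepLeft {x i j i' j' : ℕ} {e : Event C T} {o o' : Option C} (h : D[x]? = some e)
      (hu : UpperEdge e i i' o) (hl : LowerEdge e j j' o') (hij : i < j) (hij' : i' < j')
      (P : Piece D .left x i j) : Piece D .left (x + 1) i' j'
  /-- The segment continues from right to left. -/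
  | stepRight {x i j i' j' : ℕ} {e : Event C T} {o o' : Option C} (h : D[x]? = some e)
      (hu : UpperEdge e i i' o) (hl : LowerEdge e j j' o') (hij : i < j) (hij' : i' < j')
      (P : Piece D .right (x + 1) i' j') : Piece D .right x i j
  /-- Two segments merge around a right cap: the cut is to the right of the cap. -/
  | merge {x p i j : ℕ} {t : T} (h : D[x]? = some (.rightCap p t)) (hi : i < p) (hj : p ≤ j)
      (P : Piece D .left x i p) (Q : Piece D .left x (p + 1) (j + 2)) : Piece D .left (x + 1) i j
  /-- Two segments merge around a right cap: the cut is the upper segment to the left. -/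
  | mergeUpper {x p i j : ℕ} {t : T} (h : D[x]? = some (.rightCap p t)) (hi : i < p) (hj : p ≤ j)
      (P : Piece D .left x (p + 1) (j + 2)) (Q : Piece D .right (x + 1) i j) :
      Piece D .right x i p
  /-- Two segments merge around a right cap: the cut is the lower segment to the left. -/
  | mergeLower {x p i j : ℕ} {t : T} (h : D[x]? = some (.rightCap p t)) (hi : i < p) (hj : p ≤ j)
      (P : Piece D .left x i p) (Q : Piece D .right (x + 1) i j) :
      Piece D .right x (p + 1) (j + 2)
  /-- A segment splits around a left cap: the cut is to the left of the cap. -/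
  | split {x p i j : ℕ} (h : D[x]? = some (.leftCap p)) (hi : i < p) (hj : p ≤ j)
      (P : Piece D .right (x + 1) i p) (Q : Piece D .right (x + 1) (p + 1) (j + 2)) :
      Piece D .right x i j
  /-- A segment splits around a left cap: the cut is the upper segment to the right. -/
  | splitUpper {x p i j : ℕ} (h : D[x]? = some (.leftCap p)) (hi : i < p) (hj : p ≤ j)
      (P : Piece D .left x i j) (Q : Piece D .right (x + 1) (p + 1) (j + 2)) :
      Piece D .left (x + 1) i p
  /-- A segment splits around a left cap: the cut is the lower segment to the right. -/
  | splitLower {x p i j : ℕ} (h : D[x]? = some (.leftCap p)) (hi : i < p) (hj : p ≤ j)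
      (P : Piece D .left x i j) (Q : Piece D .right (x + 1) i p) :
      Piece D .left (x + 1) (p + 1) (j + 2)

/-- The immersed disks whose only corner at a positive quadrant is at the Reeb chord `c`: that
corner occupies the left or the right quadrant of the crossing `c`. -/
inductive Disk {C T : Type} (D : Diagram C T) (c : C) : Type
  | leftQuadrant {x p : ℕ} (h : D[x]? = some (.crossing p c)) (P : Piece D .left x p (p + 1)) :
      Disk D c
  | rightQuadrant {x p : ℕ} (h : D[x]? = some (.crossing p c))
      (P : Piece D .right (x + 1) p (p + 1)) : Disk D c

/-! ## The fully non-commutative Chekanov-Eliashberg dga -/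

/-- Reduced words in the Reeb chords `C` and in the formal variables `t, t⁻¹`, `t ∈ T`. -/
abbrev CEWord (C T : Type) : Type := Monoid.Coprod (FreeMonoid C) (FreeGroup T)

/-- The underlying algebra: the `ℤ/2`-algebra freely generated by the Reeb chords and the
`t^{±1}`, subject only to `t t⁻¹ = t⁻¹ t = 1`. -/
abbrev CEAlg (C T : Type) : Type := MonoidAlgebra (ZMod 2) (CEWord C T)

section DGA

variable {C T : Type}

/-- A Reeb chord as a word. -/
def chordWord (c : C) : CEWord C T := Monoid.Coprod.inl (FreeMonoid.of c)

/-- A marked point as a word. -/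
def markWord (t : T) : CEWord C T := Monoid.Coprod.inr (FreeGroup.of t)

/-- The word of a possible corner. -/
def cornerWord : Option C → CEWord C T
  | none => 1
  | some c => chordWord c

/-- The word read along the boundary of a piece, in the direction of the boundary of the disk
(counterclockwise, so that the disk is on the left hand): for a piece to the left of the cut from
the upper to the lower end of the cut, for a piece to the right from the lower to the upper end.
A corner at a negative quadrant contributes its Reeb chord.  A right cap contributes its marked
point `t` if it is traversed downwards (disk to the right of the cap), and `t⁻¹` if upwards. -/
def Piece.word {D : Diagram C T} : {s : Side} → {x i j : ℕ} → Piece D s x i j → CEWord C T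
  | _, _, _, _, .birth _ => 1
  | _, _, _, _, .death (t := t) _ => (Monoid.Coprod.inr (FreeGroup.of t)⁻¹)
  | _, _, _, _, .stepLeft (o := o) (o' := o') _ _ _ _ _ P =>
      cornerWord o * P.word * cornerWord o'
  | _, _, _, _, .stepRight (o := o) (o' := o') _ _ _ _ _ P =>
      cornerWord o' * P.word * cornerWord o
  | _, _, _, _, .merge (t := t) _ _ _ P Q => P.word * markWord t * Q.word
  | _, _, _, _, .mergeUpper (t := t) _ _ _ P Q => markWord t * P.word * Q.word
  | _, _, _, _, .mergeLower (t := t) _ _ _ P Q => Q.word * P.word * markWord t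
  | _, _, _, _, .split _ _ _ P Q => Q.word * P.word
  | _, _, _, _, .splitUpper _ _ _ P Q => P.word * Q.word
  | _, _, _, _, .splitLower _ _ _ P Q => Q.word * P.word

/-- The word of a disk, read counterclockwise from its positive corner. -/
def Disk.word {D : Diagram C T} {c : C} : Disk D c → CEWord C T
  | .leftQuadrant _ P => P.word
  | .rightQuadrant _ P => P.word

/-- The differential of a Reeb chord: the sum of the words of all disks. -/
noncomputable def chordDiff (D : Diagram C T) (c : C) : CEAlg C T :=
  ∑ᶠ u : Disk D c, MonoidAlgebra.of (ZMod 2) (CEWord C T) u.word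

/-- The multiplicative map `x ↦ (x, ∂x; 0, x)` on words, where `∂c` is the given differential of
the Reeb chord `c` and `∂t = ∂t⁻¹ = 0`. -/
noncomputable def dualWord (D : Diagram C T) :
    CEWord C T →* Matrix (Fin 2) (Fin 2) (CEAlg C T) :=
  Monoid.Coprod.lift
    (FreeMonoid.lift fun c =>
      !![MonoidAlgebra.of (ZMod 2) (CEWord C T) (chordWord c), chordDiff D c;
         0, MonoidAlgebra.of (ZMod 2) (CEWord C T) (chordWord c)])
    ((Matrix.scalar (Fin 2) : CEAlg C T →+* _).toMonoidHom.comp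
      ((MonoidAlgebra.of (ZMod 2) (CEWord C T)).comp Monoid.Coprod.inr))

/-- The map `x ↦ (x, ∂x; 0, x)` on the whole algebra. -/
noncomputable def dualAlg (D : Diagram C T) :
    CEAlg C T →ₐ[ZMod 2] Matrix (Fin 2) (Fin 2) (CEAlg C T) :=
  MonoidAlgebra.lift (ZMod 2) _ (CEWord C T) (dualWord D)

/-- The differential of the Chekanov-Eliashberg dga: the extension of the differential of the Reeb
chords by `∂t = ∂t⁻¹ = 0` and by the Leibniz rule. -/
noncomputable def ceDiff (D : Diagram C T) (x : CEAlg C T) : CEAlg C T := dualAlg D x 0 1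

end DGA

section DGALemmas

variable {C T : Type} (D : Diagram C T)

lemma dualWord_spec (m : CEWord C T) :
    dualWord D m 0 0 = MonoidAlgebra.of (ZMod 2) _ m ∧ dualWord D m 1 0 = 0 ∧
      dualWord D m 1 1 = MonoidAlgebra.of (ZMod 2) _ m := by
  have hmul : ∀ a b : CEWord C T,
      (dualWord D a 0 0 = MonoidAlgebra.of (ZMod 2) _ a ∧ dualWord D a 1 0 = 0 ∧
        dualWord D a 1 1 = MonoidAlgebra.of (ZMod 2) _ a) →
      (dualWord D b 0 0 = MonoidAlgebra.of (ZMod 2) _ b ∧ dualWord D b 1 0 = 0 ∧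
        dualWord D b 1 1 = MonoidAlgebra.of (ZMod 2) _ b) →
      (dualWord D (a * b) 0 0 = MonoidAlgebra.of (ZMod 2) _ (a * b) ∧ dualWord D (a * b) 1 0 = 0 ∧
        dualWord D (a * b) 1 1 = MonoidAlgebra.of (ZMod 2) _ (a * b)) := by
    rintro a b ⟨h1, h2, h3⟩ ⟨h4, h5, h6⟩
    refine ⟨?_, ?_, ?_⟩ <;>
      simp only [map_mul, Matrix.mul_apply, Fin.sum_univ_two, h1, h2, h3, h4, h5, h6, mul_zero,
        zero_mul, add_zero, zero_add]
  induction m using Monoid.Coprod.induction_on with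
  | inl m =>
    induction m using FreeMonoid.inductionOn with
    | one => simp [MonoidAlgebra.one_def]
    | of c => simp [dualWord, chordWord]
    | mul a b ha hb => rw [map_mul]; exact hmul _ _ ha hb
  | inr g => simp [dualWord]
  | mul a b ha hb => exact hmul _ _ ha hb

lemma dualAlg_spec (x : CEAlg C T) :
    dualAlg D x 0 0 = x ∧ dualAlg D x 1 0 = 0 ∧ dualAlg D x 1 1 = x := by
  induction x using MonoidAlgebra.induction_on with
  | of m =>
    have := dualWord_spec D m
    simpa [dualAlg] using this
  | add a b ha hb => simp [ha.1, ha.2.1, ha.2.2, hb.1, hb.2.1, hb.2.2]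
  | smul r a ha => simp [ha.1, ha.2.1, ha.2.2]

/-- The Leibniz rule. -/
lemma ceDiff_mul (x y : CEAlg C T) : ceDiff D (x * y) = ceDiff D x * y + x * ceDiff D y := by
  have hx := dualAlg_spec D x
  have hy := dualAlg_spec D y
  simp [ceDiff, Matrix.mul_apply, Fin.sum_univ_two, hx.1, hy.2.2, add_comm]

lemma ceDiff_add (x y : CEAlg C T) : ceDiff D (x + y) = ceDiff D x + ceDiff D y := by
  simp [ceDiff]

lemma ceDiff_chord (c : C) :
    ceDiff D (MonoidAlgebra.of (ZMod 2) (CEWord C T) (chordWord c)) = chordDiff D c := by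
  simp [ceDiff, dualAlg, dualWord, chordWord]

lemma ceDiff_marks (g : FreeGroup T) :
    ceDiff D (MonoidAlgebra.of (ZMod 2) (CEWord C T) (Monoid.Coprod.inr g)) = 0 := by
  simp [ceDiff, dualAlg, dualWord]

end DGALemmas

/-! ## Augmentations and the augmentation variety -/

/-- An augmentation with values in a commutative ring `R` of characteristic two, placed in degree
`0` with zero differential: a unital homomorphism of dgas. -/
@[ext]
structure Augmentation {C T : Type} (D : Diagram C T) (deg : C → ℤ) (R : Type u) [CommRing R]
    where
  /-- the underlying ring homomorphism -/
  hom : CEAlg C T →+* R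
  map_diff : ∀ x, hom (ceDiff D x) = 0
  map_chord : ∀ c, deg c ≠ 0 → hom (MonoidAlgebra.of _ _ (chordWord c)) = 0

section AugRing

variable (F : Type u) [Field F] [CharP F 2] {C T : Type}

variable (C T) in
/-- The commutative algebra `F[c, t^{±1} | c ∈ C, t ∈ T]`, which is the abelianization of the
Chekanov-Eliashberg algebra with coefficients extended to `F`: polynomials in the Reeb chords over
the ring of Laurent polynomials in the marked points. -/
abbrev CommCEAlg : Type u := MvPolynomial C (MonoidAlgebra F (Multiplicative (T →₀ ℤ)))

/-- The marked points, as units of the commutative algebra. -/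
noncomputable def commMark : FreeGroup T →* CommCEAlg F C T :=
  (MvPolynomial.C.toMonoidHom.comp (MonoidAlgebra.of F (Multiplicative (T →₀ ℤ)))).comp
    (FreeGroup.lift fun t => Multiplicative.ofAdd (Finsupp.single t 1))

/-- The homomorphism from the Chekanov-Eliashberg algebra to its abelianization over `F`. -/
noncomputable def abel : CEAlg C T →+* CommCEAlg F C T :=
  MonoidAlgebra.liftNCRingHom
    ((algebraMap F (CommCEAlg F C T)).comp (ZMod.castHom (dvd_refl 2) F))
    (Monoid.Coprod.lift (FreeMonoid.lift fun c => MvPolynomial.X c) (commMark F))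
    (fun _ _ => Commute.all _ _)

/-- The ideal of the abelianization generated by the Reeb chords of nonzero degree and by the image
of the differential. -/
noncomputable def augIdeal (D : Diagram C T) (deg : C → ℤ) : Ideal (CommCEAlg F C T) :=
  Ideal.span ({f | ∃ c, deg c ≠ 0 ∧ f = MvPolynomial.X c} ∪
    {f | ∃ x : CEAlg C T, f = abel F (ceDiff D x)})

/-- The coordinate ring of the augmentation variety.  For a dga in non-negative degrees it is
`H_0(A^c, F)`: the algebra generated by the Reeb chords of degree `0` and the invertible formal
variables, modulo the differentials of the Reeb chords of degree `1`. -/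
abbrev AugRing (D : Diagram C T) (deg : C → ℤ) : Type u := CommCEAlg F C T ⧸ augIdeal F D deg

/-- The homomorphism from the Chekanov-Eliashberg algebra to the coordinate ring of the
augmentation variety. -/
noncomputable def toAugRing (D : Diagram C T) (deg : C → ℤ) : CEAlg C T →+* AugRing F D deg :=
  (Ideal.Quotient.mk (augIdeal F D deg)).comp (abel F)

variable {F}

lemma abel_chord (c : C) :
    abel F (MonoidAlgebra.of (ZMod 2) (CEWord C T) (chordWord c)) = MvPolynomial.X c := by
  simp only [abel, chordWord, MonoidAlgebra.of_apply]
  erw [MonoidAlgebra.liftNC_single]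
  refine (congrArg₂ (· * ·) (map_one ((algebraMap F (CommCEAlg F C T)).comp
    (ZMod.castHom (dvd_refl 2) F))) rfl).trans ((one_mul _).trans ?_)
  simp

lemma abel_mark (g : FreeGroup T) :
    abel F (MonoidAlgebra.of (ZMod 2) (CEWord C T) (Monoid.Coprod.inr g)) = commMark F g := by
  simp only [abel, MonoidAlgebra.of_apply]
  erw [MonoidAlgebra.liftNC_single]
  refine (congrArg₂ (· * ·) (map_one ((algebraMap F (CommCEAlg F C T)).comp
    (ZMod.castHom (dvd_refl 2) F))) rfl).trans ((one_mul _).trans ?_)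
  simp

/-- The augmentation given by a point of the affine scheme `Spec (AugRing F D deg)`. -/
noncomputable def Augmentation.ofPoint {D : Diagram C T} {deg : C → ℤ} {R : Type u} [CommRing R]
    [Algebra F R] (f : AugRing F D deg →ₐ[F] R) : Augmentation D deg R where
  hom := (f : AugRing F D deg →+* R).comp (toAugRing F D deg)
  map_diff x := by
    have : toAugRing F D deg (ceDiff D x) = 0 :=
      Ideal.Quotient.eq_zero_iff_mem.2 (Ideal.subset_span (Or.inr ⟨x, rfl⟩))
    simp [this]
  map_chord c hc := by
    have : toAugRing F D deg (MonoidAlgebra.of _ _ (chordWord c)) = 0 :=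
      Ideal.Quotient.eq_zero_iff_mem.2 (Ideal.subset_span (Or.inl ⟨c, hc, abel_chord c⟩))
    simp only [RingHom.comp_apply, this, map_zero]

/-- The scheme `Spec (AugRing F D deg)` is the moduli space of augmentations: its points with
values in a commutative `F`-algebra `R` are the augmentations with values in `R`. -/
theorem Augmentation.ofPoint_bijective {D : Diagram C T} {deg : C → ℤ} {R : Type u} [CommRing R]
    [Algebra F R] :
    Function.Bijective (Augmentation.ofPoint : (AugRing F D deg →ₐ[F] R) → Augmentation D deg R) := by
  have hpt : ∀ (f : AugRing F D deg →ₐ[F] R) (x : CEAlg C T),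
      (Augmentation.ofPoint f).hom x = f (Ideal.Quotient.mk _ (abel F x)) := fun _ _ => rfl
  constructor
  · intro f g hfg
    have h : ∀ x : CEAlg C T,
        f (Ideal.Quotient.mk _ (abel F x)) = g (Ideal.Quotient.mk _ (abel F x)) := fun x => by
      rw [← hpt f, ← hpt g, hfg]
    apply Ideal.Quotient.algHom_ext
    apply AlgHom.coe_ringHom_injective
    apply MvPolynomial.ringHom_ext'
    · apply MonoidAlgebra.ringHom_ext
      · intro r
        have e : (MvPolynomial.C (MonoidAlgebra.single 1 r) : CommCEAlg F C T) =
            algebraMap F _ r := rfl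
        simp only [RingHom.comp_apply, e]
        exact ((f.comp (Ideal.Quotient.mkₐ F _)).commutes r).trans
          ((g.comp (Ideal.Quotient.mkₐ F _)).commutes r).symm
      · intro m
        have hm : ∃ y : FreeGroup T, FreeGroup.lift
            (fun t => Multiplicative.ofAdd (Finsupp.single t (1 : ℤ))) y = m := by
          rw [← MonoidHom.mem_range]
          suffices H : ∀ v : T →₀ ℤ, Multiplicative.ofAdd v ∈ (FreeGroup.lift
            (fun t => Multiplicative.ofAdd (Finsupp.single t (1 : ℤ)))).range from H m.toAdd
          intro v
          induction v using Finsupp.induction_linear with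
          | zero => exact Subgroup.one_mem _
          | add a b ha hb => exact Subgroup.mul_mem _ ha hb
          | single t k =>
            have : Multiplicative.ofAdd (Finsupp.single t k) =
                (Multiplicative.ofAdd (Finsupp.single t (1 : ℤ))) ^ k := by
              rw [← ofAdd_zsmul]; simp
            rw [this]
            exact Subgroup.zpow_mem _ (MonoidHom.mem_range.2 ⟨FreeGroup.of t, by simp⟩) k
        obtain ⟨y, rfl⟩ := hm
        have := h (MonoidAlgebra.of (ZMod 2) (CEWord C T) (Monoid.Coprod.inr y))
        rw [abel_mark] at this
        exact this
    · intro c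
      have := h (MonoidAlgebra.of (ZMod 2) (CEWord C T) (chordWord c))
      rw [abel_chord] at this
      exact this
  · intro ε
    let u : FreeGroup T →* Rˣ := (((ε.hom : CEAlg C T →* R).comp
      (MonoidAlgebra.of (ZMod 2) (CEWord C T))).comp Monoid.Coprod.inr).toHomUnits
    let v : Multiplicative (T →₀ ℤ) →* Rˣ := AddMonoidHom.toMultiplicativeLeft
      (Finsupp.liftAddHom fun t => zmultiplesHom (Additive Rˣ) (Additive.ofMul (u (FreeGroup.of t))))
    have hv : ∀ t, v (Multiplicative.ofAdd (Finsupp.single t 1)) = u (FreeGroup.of t) := by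
      intro t; simp [v]
    let c₀ : MonoidAlgebra F (Multiplicative (T →₀ ℤ)) →ₐ[F] R :=
      MonoidAlgebra.lift F R _ ((Units.coeHom R).comp v)
    let g : CommCEAlg F C T →ₐ[F] R :=
      { MvPolynomial.eval₂Hom (c₀ : _ →+* R)
          (fun c => ε.hom (MonoidAlgebra.of _ _ (chordWord c))) with
        commutes' := fun r => by
          have e : (algebraMap F (CommCEAlg F C T) r) =
            MvPolynomial.C (algebraMap F (MonoidAlgebra F (Multiplicative (T →₀ ℤ))) r) := rfl
          simp [e, -MonoidAlgebra.coe_algebraMap] }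
    have hg : ∀ p, g p = MvPolynomial.eval₂Hom (c₀ : _ →+* R)
          (fun c => ε.hom (MonoidAlgebra.of _ _ (chordWord c))) p := fun _ => rfl
    have hgX : ∀ c, g (MvPolynomial.X c) = ε.hom (MonoidAlgebra.of _ _ (chordWord c)) := by
      intro c; rw [hg]; simp
    have hgm : ∀ y : FreeGroup T, g (commMark F y) = u y := by
      intro y
      have : ((g : CommCEAlg F C T →* R).comp (commMark F)) = (Units.coeHom R).comp u := by
        ext t
        simp only [MonoidHom.comp_apply, Units.coeHom_apply, commMark, ← hv]
        have : g (MvPolynomial.C (MonoidAlgebra.of F (Multiplicative (T →₀ ℤ))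
          (Multiplicative.ofAdd (Finsupp.single t 1)))) =
          c₀ (MonoidAlgebra.of F (Multiplicative (T →₀ ℤ))
          (Multiplicative.ofAdd (Finsupp.single t 1))) := by rw [hg]; simp
        simpa [c₀] using this
      exact DFunLike.congr_fun this y
    have hga : ∀ x, g (abel F x) = ε.hom x := by
      intro x
      have : (g : CommCEAlg F C T →+* R).comp (abel F) = ε.hom := by
        apply MonoidAlgebra.ringHom_ext'
        · exact Subsingleton.elim _ _
        · apply Monoid.Coprod.hom_ext
          · ext c
            have := hgX c
            rw [← abel_chord] at this
            exact this
          · ext t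
            have := hgm (FreeGroup.of t)
            rw [← abel_mark] at this
            exact this
      exact RingHom.congr_fun this x
    refine ⟨Ideal.Quotient.liftₐ _ g ?_, ?_⟩
    · intro a ha
      have : augIdeal F D deg ≤ RingHom.ker (g : CommCEAlg F C T →+* R) := by
        refine Ideal.span_le.2 ?_
        rintro a (⟨c, hc, rfl⟩ | ⟨x, rfl⟩)
        · exact (hgX c).trans (ε.map_chord c hc)
        · exact (hga _).trans (ε.map_diff x)
      exact this ha
    · exact Augmentation.ext (RingHom.ext hga)

end AugRing

/-! ## The Legendrian link of a positive braid word -/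

/-- The Reeb chords of `Λ_β` for a word of length `l` in `n` strands: the crossings of the braid
and the crossings next to the `n` right cusps. -/
inductive LinkChord (l n : ℕ) : Type
  | braid (k : Fin l)
  | cusp (k : Fin n)

/-- The degrees for the binary Maslov potential: braid crossings have degree `0`, cusps degree `1`. -/
def LinkChord.degree {l n : ℕ} : LinkChord l n → ℤ
  | .braid _ => 0
  | .cusp _ => 1

/-- The Lagrangian projection, after Ng's resolution, of the rainbow closure `Λ_β` of a braid word
on `n` strands, with one marked point next to each right cusp.  The `n` left cusps are nested, the
outermost one first.  Then the lower `n` strands (numbered `n, …, 2n - 1` from top to bottom) run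
through the braid, oriented from left to right, whereas the upper `n` strands run parallel and are
oriented from right to left.  Finally the right cusps are closed, the innermost one first. -/
def linkDiagram {n : ℕ} (w : BraidWord n) : Diagram (LinkChord w.length n) (Fin n) :=
  (List.range n).map Event.leftCap ++
    (List.finRange w.length).map (fun k => Event.crossing (n + w.get k) (LinkChord.braid k)) ++
    (List.finRange n).flatMap (fun k : Fin n =>
      [Event.crossing (n - 1 - (k : ℕ)) (LinkChord.cusp k), Event.rightCap (n - 1 - (k : ℕ)) k])

section AugVariety

variable (F : Type u) [Field F] [CharP F 2] {n : ℕ}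

/-- The coordinate ring of `Aug(Λ_β)`, for a word of `β`. -/
abbrev LinkAugRing (w : BraidWord n) : Type u := AugRing F (linkDiagram w) LinkChord.degree

/-- The Reeb coordinates `b_1, …, b_l` on `Aug(Λ_β)`. -/
noncomputable def reebCoord (w : BraidWord n) (k : Fin w.length) : LinkAugRing F w :=
  toAugRing F _ _ (MonoidAlgebra.of _ _ (chordWord (LinkChord.braid k)))

/-- The invertible functions `t_1, …, t_n` on `Aug(Λ_β)` given by the marked points. -/
noncomputable def markCoord (w : BraidWord n) (k : Fin n) : LinkAugRing F w :=
  toAugRing F _ _ (MonoidAlgebra.of _ _ (markWord k))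

/-- The augmentation variety `Aug(Λ_β) = Spec (LinkAugRing F w)`, given by its functor of points on
commutative `F`-algebras. -/
noncomputable def augVariety (w : BraidWord n) : CommAlgCat.{u} F ⥤ Type u :=
  coyoneda.obj (Opposite.op (CommAlgCat.of F (LinkAugRing F w)))

end AugVariety

/-! ## Flags for `SL_n` -/

section Flags

open Matrix

variable (n : ℕ) (R : Type u) [CommRing R]

/-- The Borel subgroup `B₊` of upper triangular matrices in `SL_n`. -/
def borelPos : Subgroup (SpecialLinearGroup (Fin n) R) where
  carrier := {g | ∀ a b : Fin n, b < a → g a b = 0}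
  one_mem' a b h := by simp [h.ne']
  mul_mem' {g h} hg hh := by
    have : BlockTriangular (g.1 * h.1) id :=
      BlockTriangular.mul (fun a b => hg a b) (fun a b => hh a b)
    exact fun a b hab => this hab
  inv_mem' {g} hg := by
    have h0 : g.1 * (g⁻¹).1 = 1 := congrArg Subtype.val (mul_inv_cancel g)
    have h1 : (g.1)⁻¹ = (g⁻¹).1 := Matrix.inv_eq_right_inv h0
    have := invertibleOfRightInverse _ _ h0
    have h2 : BlockTriangular (g.1)⁻¹ id :=
      blockTriangular_inv_of_blockTriangular (fun a b => hg a b)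
    rw [h1] at h2
    exact fun a b hab => h2 hab

/-- The opposite Borel subgroup `B₋` of lower triangular matrices in `SL_n`. -/
def borelNeg : Subgroup (SpecialLinearGroup (Fin n) R) where
  carrier := {g | ∀ a b : Fin n, a < b → g a b = 0}
  one_mem' a b h := by simp [h.ne]
  mul_mem' {g h} hg hh := by
    have : BlockTriangular (g.1 * h.1) OrderDual.toDual :=
      BlockTriangular.mul (fun a b => hg a b) (fun a b => hh a b)
    exact fun a b hab => this hab
  inv_mem' {g} hg := by
    have h0 : g.1 * (g⁻¹).1 = 1 := congrArg Subtype.val (mul_inv_cancel g)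
    have h1 : (g.1)⁻¹ = (g⁻¹).1 := Matrix.inv_eq_right_inv h0
    have := invertibleOfRightInverse _ _ h0
    have h2 : BlockTriangular (g.1)⁻¹ OrderDual.toDual :=
      blockTriangular_inv_of_blockTriangular (fun a b => hg a b)
    rw [h1] at h2
    exact fun a b hab => h2 hab

variable {n R} in
lemma borelNeg_diag_mul {g h : SpecialLinearGroup (Fin n) R} (hg : g ∈ borelNeg n R)
    (hh : h ∈ borelNeg n R) (a : Fin n) : (g * h) a a = g a a * h a a := by
  refine (Matrix.mul_apply (M := g.1) (N := h.1)).trans ?_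
  refine Finset.sum_eq_single a (fun b _ hb => ?_) (by simp)
  rcases lt_or_gt_of_ne hb with h' | h'
  · rw [hh b a h', mul_zero]
  · rw [hg a b h', zero_mul]

/-- The maximal unipotent subgroup `U₋` of `B₋`: lower triangular matrices with diagonal `1`. -/
def unipNeg : Subgroup (SpecialLinearGroup (Fin n) R) where
  carrier := {g | g ∈ borelNeg n R ∧ ∀ a : Fin n, g a a = 1}
  one_mem' := ⟨one_mem _, fun a => by simp⟩
  mul_mem' {g h} hg hh := ⟨mul_mem hg.1 hh.1, fun a => by
    rw [borelNeg_diag_mul hg.1 hh.1, hg.2, hh.2, one_mul]⟩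
  inv_mem' {g} hg := ⟨inv_mem hg.1, fun a => by
    have := borelNeg_diag_mul hg.1 (inv_mem hg.1) a
    rw [hg.2, one_mul, mul_inv_cancel] at this
    simpa using this.symm⟩

/-- The flags `SL_n / B₊`, cosets `y B₊`. -/
abbrev SLFlag : Type u := SpecialLinearGroup (Fin n) R ⧸ borelPos n R

/-- The decorated flags `U₋ \ SL_n`, cosets `U₋ x`. -/
abbrev DecFlag : Type u := Quotient (QuotientGroup.rightRel (unipNeg n R))

variable {n R}

/-- The decorated flag `U₋ x`. -/
def DecFlag.mk (x : SpecialLinearGroup (Fin n) R) : DecFlag n R :=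
  Quotient.mk (QuotientGroup.rightRel (unipNeg n R)) x

/-- The action of the group on decorated flags, `g · U₋ x = U₋ x g⁻¹`. -/
def DecFlag.act (g : SpecialLinearGroup (Fin n) R) : DecFlag n R → DecFlag n R :=
  Quotient.map (fun x => x * g⁻¹) fun x y h => by
    rw [← Quotient.eq_iff_equiv, Quotient.eq, QuotientGroup.rightRel_apply] at h ⊢
    simpa [mul_assoc] using h

/-- Strand `i` as a row index. -/
def rowLo (i : Fin (n - 1)) : Fin n := ⟨i, by omega⟩

/-- Strand `i + 1` as a row index. -/
def rowHi (i : Fin (n - 1)) : Fin n := ⟨i + 1, by omega⟩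

/-- The matrix with the `2 × 2` block `A` in the rows and columns `i` and `i + 1`, and equal to the
identity matrix elsewhere. -/
def blockMatrix (i : Fin (n - 1)) (A : Matrix (Fin 2) (Fin 2) R) : Matrix (Fin n) (Fin n) R :=
  fun a b =>
    if a = rowLo i then (if b = rowLo i then A 0 0 else if b = rowHi i then A 0 1 else 0)
    else if a = rowHi i then (if b = rowLo i then A 1 0 else if b = rowHi i then A 1 1 else 0)
    else if a = b then 1 else 0

lemma det_blockMatrix (i : Fin (n - 1)) (A : Matrix (Fin 2) (Fin 2) R) :
    (blockMatrix i A).det = A.det := by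
  have hne : rowLo i ≠ rowHi i := by simp [rowLo, rowHi, Fin.ext_iff]
  let p : Fin n → Prop := fun a => a = rowLo i ∨ a = rowHi i
  rw [Matrix.twoBlockTriangular_det (blockMatrix i A) p]
  · have h1 : toSquareBlockProp (blockMatrix i A) (fun a => ¬ p a) = 1 := by
      ext ⟨a, ha⟩ ⟨b, hb⟩
      simp only [p, not_or] at ha hb
      simp [toSquareBlockProp, blockMatrix, ha.1, ha.2, Matrix.one_apply]
    let e : Fin 2 ≃ {a // p a} :=
      Equiv.ofBijective ![⟨rowLo i, Or.inl rfl⟩, ⟨rowHi i, Or.inr rfl⟩] (by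
        constructor
        · intro a b h
          fin_cases a <;> fin_cases b <;> simp_all [Subtype.ext_iff, hne.symm]
        · rintro ⟨a, rfl | rfl⟩
          · exact ⟨0, rfl⟩
          · exact ⟨1, rfl⟩)
    have h2 : (toSquareBlockProp (blockMatrix i A) p).submatrix e e = A := by
      ext a b
      have e0 : (e 0).1 = rowLo i := rfl
      have e1 : (e 1).1 = rowHi i := rfl
      fin_cases a <;> fin_cases b <;>
        simp [toSquareBlockProp, blockMatrix, hne.symm, e0, e1]
    rw [h1, det_one, mul_one, ← det_submatrix_equiv_self e, h2]
  · intro a ha b hb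
    simp only [p, not_or] at ha hb
    have hab : a ≠ b := by rintro rfl; exact hb.elim ha.1 ha.2
    simp [blockMatrix, ha.1, ha.2, hab]

/-- The homomorphism `φ_i : SL_2 → SL_n` of the `i`-th simple root, as a map. -/
def rootMap (i : Fin (n - 1)) (A : SpecialLinearGroup (Fin 2) R) :
    SpecialLinearGroup (Fin n) R :=
  ⟨blockMatrix i A.1, (det_blockMatrix i A.1).trans A.2⟩

/-- `e_i(q)`. -/
def rootElt (i : Fin (n - 1)) (q : R) : SpecialLinearGroup (Fin n) R :=
  rootMap i ⟨!![1, q; 0, 1], by simp⟩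

/-- The lift `s̄_i` of the simple reflection. -/
def sBar (R : Type u) [CommRing R] (i : Fin (n - 1)) : SpecialLinearGroup (Fin n) R :=
  rootMap i ⟨!![0, -1; 1, 0], by simp⟩

/-- `R_i(q) = e_i(q) s̄_i`. -/
def rMat (i : Fin (n - 1)) (q : R) : SpecialLinearGroup (Fin n) R := rootElt i q * sBar R i

/-- `x B₊ —s_i→ y B₊`, that is `x⁻¹ y ∈ B₊ s_i B₊`. -/
def SLFlag.RelPos (i : Fin (n - 1)) (B B' : SLFlag n R) : Prop :=
  ∃ x y : SpecialLinearGroup (Fin n) R, (x : SLFlag n R) = B ∧ (y : SLFlag n R) = B' ∧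
    ∃ b ∈ borelPos n R, ∃ b' ∈ borelPos n R, x⁻¹ * y = b * sBar R i * b'

/-- General position of a decorated flag and a flag: `U₋ x — y B₊`, that is `x y ∈ B₋ B₊`. -/
def GeneralPosition (A : DecFlag n R) (B : SLFlag n R) : Prop :=
  ∃ x y : SpecialLinearGroup (Fin n) R, DecFlag.mk x = A ∧ (y : SLFlag n R) = B ∧
    ∃ b ∈ borelNeg n R, ∃ b' ∈ borelPos n R, x * y = b * b'

/-! ## Half decorated double Bott-Samelson cells -/

/-- The collections parametrized by `Conf^e_β(C)`, for the chain given by a word of `β`: a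
decorated flag `A`, and a chain of flags `B⁰ → B¹ → ⋯ → Bˡ` in the relative positions given by the
letters of the word, such that `A` is in general position both with `B⁰` and with `Bˡ`. -/
@[ext]
structure Collection {n : ℕ} (w : BraidWord n) (R : Type u) [CommRing R] where
  /-- the decorated flag on top -/
  top : DecFlag n R
  /-- the chain of flags at the bottom -/
  flag : Fin (w.length + 1) → SLFlag n R
  step : ∀ k : Fin w.length, (flag k.castSucc).RelPos (w.get k) (flag k.succ)
  gen_left : GeneralPosition top (flag 0)
  gen_right : GeneralPosition top (flag (Fin.last _))

lemma DecFlag.act_one (A : DecFlag n R) : A.act 1 = A := by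
  induction A using Quotient.inductionOn with
  | h x => simp [DecFlag.act]

lemma DecFlag.act_mul (g h : SpecialLinearGroup (Fin n) R) (A : DecFlag n R) :
    A.act (g * h) = (A.act h).act g := by
  induction A using Quotient.inductionOn with
  | h x => simp [DecFlag.act, mul_assoc]

/-- Two collections lie in the same orbit of `SL_n`. -/
def Collection.orbitSetoid {n : ℕ} (w : BraidWord n) (R : Type u) [CommRing R] :
    Setoid (Collection w R) where
  r X Y := ∃ g : SpecialLinearGroup (Fin n) R,
    X.top.act g = Y.top ∧ ∀ k, g • X.flag k = Y.flag k
  iseqv := by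
    refine ⟨fun X => ⟨1, X.top.act_one, fun k => one_smul _ _⟩, ?_, ?_⟩
    · rintro X Y ⟨g, h1, h2⟩
      refine ⟨g⁻¹, ?_, fun k => ?_⟩
      · rw [← h1, ← DecFlag.act_mul, inv_mul_cancel, DecFlag.act_one]
      · rw [← h2, inv_smul_smul]
    · rintro X Y Z ⟨g, h1, h2⟩ ⟨h, h3, h4⟩
      refine ⟨h * g, ?_, fun k => ?_⟩
      · rw [DecFlag.act_mul, h1, h3]
      · rw [mul_smul, h2, h4]

/-- The `R`-points of `Conf^e_β(C)`: the `SL_n`-orbits of collections. -/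
def Conf {n : ℕ} (w : BraidWord n) (R : Type u) [CommRing R] : Type u :=
  Quotient (Collection.orbitSetoid w R)

/-- The orbit of a collection. -/
def Conf.mk {n : ℕ} {w : BraidWord n} {R : Type u} [CommRing R] (X : Collection w R) : Conf w R :=
  Quotient.mk (Collection.orbitSetoid w R) X

/-- `(q_1, …, q_l)` are the affine coordinates of a point of `Conf^e_β(C)`: the point is the orbit
of the collection with top `U₋` and chain `B^k = R_{i_1}(q_1) ⋯ R_{i_k}(q_k) B₊`. -/
def Conf.HasCoords {n : ℕ} {w : BraidWord n} {R : Type u} [CommRing R] (c : Conf w R)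
    (q : Fin w.length → R) : Prop :=
  ∃ X : Collection w R, Conf.mk X = c ∧ X.top = DecFlag.mk 1 ∧
    ∀ k : Fin (w.length + 1), X.flag k =
      ((((List.ofFn fun j => rMat (w.get j) (q j)).take k).prod :
        SpecialLinearGroup (Fin n) R) : SLFlag n R)

/-! ### Functoriality in the ring -/

variable {S : Type u} [CommRing S]

lemma borelPos_map (f : R →+* S) {g : SpecialLinearGroup (Fin n) R} (hg : g ∈ borelPos n R) :
    SpecialLinearGroup.map f g ∈ borelPos n S := fun a b h => by
  simp [SpecialLinearGroup.map_apply_coe, hg a b h]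

lemma borelNeg_map (f : R →+* S) {g : SpecialLinearGroup (Fin n) R} (hg : g ∈ borelNeg n R) :
    SpecialLinearGroup.map f g ∈ borelNeg n S := fun a b h => by
  simp [SpecialLinearGroup.map_apply_coe, hg a b h]

lemma unipNeg_map (f : R →+* S) {g : SpecialLinearGroup (Fin n) R} (hg : g ∈ unipNeg n R) :
    SpecialLinearGroup.map f g ∈ unipNeg n S :=
  ⟨borelNeg_map f hg.1, fun a => by simp [SpecialLinearGroup.map_apply_coe, hg.2 a]⟩

lemma sBar_map (f : R →+* S) (i : Fin (n - 1)) :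
    SpecialLinearGroup.map f (sBar R i) = sBar S i := by
  ext a b
  change f (blockMatrix i !![0, -1; 1, 0] a b) = blockMatrix i !![0, -1; 1, 0] a b
  unfold blockMatrix
  split_ifs <;> simp

/-- Base change of flags. -/
def SLFlag.map (f : R →+* S) : SLFlag n R → SLFlag n S :=
  Quotient.map (SpecialLinearGroup.map f) fun x y h => by
    rw [← Quotient.eq_iff_equiv, Quotient.eq, QuotientGroup.leftRel_apply] at h ⊢
    simpa using borelPos_map f h

/-- Base change of decorated flags. -/
def DecFlag.map (f : R →+* S) : DecFlag n R → DecFlag n S :=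
  Quotient.map (SpecialLinearGroup.map f) fun x y h => by
    rw [← Quotient.eq_iff_equiv, Quotient.eq, QuotientGroup.rightRel_apply] at h ⊢
    simpa using unipNeg_map f h

/-- Base change of collections. -/
def Collection.map {w : BraidWord n} (f : R →+* S) (X : Collection w R) : Collection w S where
  top := X.top.map f
  flag k := (X.flag k).map f
  step k := by
    obtain ⟨x, y, hx, hy, b, hb, b', hb', h⟩ := X.step k
    refine ⟨SpecialLinearGroup.map f x, SpecialLinearGroup.map f y, by rw [← hx]; rfl,
      by rw [← hy]; rfl, _, borelPos_map f hb, _, borelPos_map f hb', ?_⟩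
    rw [← sBar_map f, ← map_inv, ← map_mul, h, map_mul, map_mul]
  gen_left := by
    obtain ⟨x, y, hx, hy, b, hb, b', hb', h⟩ := X.gen_left
    refine ⟨SpecialLinearGroup.map f x, SpecialLinearGroup.map f y, by rw [← hx]; rfl,
      by rw [← hy]; rfl, _, borelNeg_map f hb, _, borelPos_map f hb', ?_⟩
    rw [← map_mul, h, map_mul]
  gen_right := by
    obtain ⟨x, y, hx, hy, b, hb, b', hb', h⟩ := X.gen_right
    refine ⟨SpecialLinearGroup.map f x, SpecialLinearGroup.map f y, by rw [← hx]; rfl,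
      by rw [← hy]; rfl, _, borelNeg_map f hb, _, borelPos_map f hb', ?_⟩
    rw [← map_mul, h, map_mul]

/-- Base change of points of `Conf^e_β(C)`. -/
def Conf.map {w : BraidWord n} (f : R →+* S) : Conf w R → Conf w S :=
  Quotient.map (Collection.map f) fun X Y ⟨g, h1, h2⟩ => by
    refine ⟨SpecialLinearGroup.map f g, ?_, fun k => ?_⟩
    · change DecFlag.act _ (X.top.map f) = Y.top.map f
      rw [← h1]
      induction X.top using Quotient.inductionOn with
      | h x => simp [DecFlag.act, DecFlag.map]
    · change _ • (X.flag k).map f = (Y.flag k).map f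
      rw [← h2]
      induction X.flag k using Quotient.inductionOn with
      | h x => exact congrArg _ (map_mul _ _ _).symm

end Flags

/-- `Conf^e_β(C)` for `SL_n`, base-changed to `F`, given by its functor of points on commutative
`F`-algebras. -/
def confVariety (F : Type u) [Field F] {n : ℕ} (w : BraidWord n) : CommAlgCat.{u} F ⥤ Type u where
  obj R := Conf w R
  map f := TypeCat.ofHom (Conf.map (f.hom : _ →+* _))
  map_id R := by
    ext c
    induction c using Quotient.inductionOn with
    | h X =>
      refine congrArg (Quotient.mk _) (Collection.ext ?_ (funext fun k => ?_))
      · change DecFlag.map _ X.top = X.top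
        induction X.top using Quotient.inductionOn with
        | h x => exact congrArg (Quotient.mk _) (by ext; rfl)
      · change (X.flag k).map _ = X.flag k
        induction X.flag k using Quotient.inductionOn with
        | h x => exact congrArg (Quotient.mk _) (by ext; rfl)
  map_comp {R S S'} f g := by
    ext c
    induction c using Quotient.inductionOn with
    | h X =>
      refine congrArg (Quotient.mk _) (Collection.ext ?_ (funext fun k => ?_))
      · change DecFlag.map _ X.top = (X.top.map _).map _
        induction X.top using Quotient.inductionOn with
        | h x => exact congrArg (Quotient.mk _) (by ext; rfl)
      · change (X.flag k).map _ = ((X.flag k).map _).map _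
        induction X.flag k using Quotient.inductionOn with
        | h x => exact congrArg (Quotient.mk _) (by ext; rfl)

/-! ## The identifications for different words of the same braid -/

/-- The change of Reeb coordinates under a braid move: an exchange of commuting letters exchanges
two coordinates, and a Legendrian Reidemeister III move replaces `(b₁, b₂, b₃)` by
`(b₃, b₂ + b₁ b₃, b₁)`.  Coordinates are numbered from `0`. -/
def BraidMove.reeb {S : Type u} [CommRing S] {n : ℕ} {w w' : BraidWord n} (m : BraidMove w w')
    (b : ℕ → S) (k : ℕ) : S :=
  match m with
  | .comm a _ _ _ _ =>
      if k = a.length then b (a.length + 1)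
      else if k = a.length + 1 then b a.length
      else b k
  | .braid a _ _ _ _ =>
      if k = a.length then b (a.length + 2)
      else if k = a.length + 1 then b (a.length + 1) + b a.length * b (a.length + 2)
      else if k = a.length + 2 then b a.length
      else b k

/-- `BraidMove.Inner m k`: the flag `B^k` lies strictly inside the part of the chain that is
affected by the braid move. -/
def BraidMove.Inner {n : ℕ} {w w' : BraidWord n} (m : BraidMove w w') (k : ℕ) : Prop :=
  match m with
  | .comm a _ _ _ _ => k = a.length + 1
  | .braid a _ _ _ _ => k = a.length + 1 ∨ k = a.length + 2

section Identifications

variable {F : Type u} [Field F] [CharP F 2] {n : ℕ}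

/-- The points of `Aug(Λ_β)` for two words that differ by a braid move correspond to each other
under the isomorphism induced by the Legendrian isotopy. -/
def BraidMove.ReebRel {w w' : BraidWord n} (m : BraidMove w w') {R : CommAlgCat.{u} F}
    (ε : (augVariety F w).obj R) (ε' : (augVariety F w').obj R) : Prop :=
  let f : LinkAugRing F w →ₐ[F] R := CommAlgCat.Hom.hom ε
  let f' : LinkAugRing F w' →ₐ[F] R := CommAlgCat.Hom.hom ε'
  (∀ k : Fin w'.length, f' (reebCoord F w' k) =
    m.reeb (fun j => if h : j < w.length then f (reebCoord F w ⟨j, h⟩) else 0) k) ∧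
  ∀ k : Fin n, f' (markCoord F w' k) = f (markCoord F w k)

/-- The points of `Conf^e_β(C)` for two words that differ by a braid move correspond to each other
if they are represented by collections that differ only in the flags strictly inside the part of
the chain that is affected by the move. -/
def BraidMove.FlagRel {w w' : BraidWord n} (m : BraidMove w w') {R : CommAlgCat.{u} F}
    (c : (confVariety F w).obj R) (c' : (confVariety F w').obj R) : Prop :=
  ∃ (X : Collection w R) (X' : Collection w' R), Conf.mk X = c ∧ Conf.mk X' = c' ∧
    X.top = X'.top ∧
    ∀ (k : ℕ) (h : k < w.length + 1) (h' : k < w'.length + 1), ¬ m.Inner k →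
      X.flag ⟨k, h⟩ = X'.flag ⟨k, h'⟩

/-- The correspondence of the points of `Aug(Λ_β)` along a sequence of braid moves. -/
def MovePath.ReebRel : {w w' : BraidWord n} → MovePath w w' → {R : CommAlgCat.{u} F} →
    (augVariety F w).obj R → (augVariety F w').obj R → Prop
  | _, _, .nil _, _, ε, ε' => ε = ε'
  | _, _, .cons m p, _, ε, ε' => ∃ ε₁, m.ReebRel ε ε₁ ∧ p.ReebRel ε₁ ε'

/-- The correspondence of the points of `Conf^e_β(C)` along a sequence of braid moves. -/
def MovePath.FlagRel : {w w' : BraidWord n} → MovePath w w' → {R : CommAlgCat.{u} F} →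
    (confVariety F w).obj R → (confVariety F w').obj R → Prop
  | _, _, .nil _, _, c, c' => c = c'
  | _, _, .cons m p, _, c, c' => ∃ c₁, m.FlagRel c c₁ ∧ p.FlagRel c₁ c'

end Identifications

/-!
Both varieties are identified, compatibly with the coordinates, with the variety `CoordCell w` of
those tuples `q` for which `M(q) = R_{i_1}(q_1) ⋯ R_{i_l}(q_l)` lies in the big cell `B₋ B₊`.

*Flags.*  A collection can be moved, by a unique element of `SL_n`, to one that starts with `U₋` and
`B₊` (`Collection.exists_act_normal`, `Collection.eq_of_normal`).  Since `B₊ s_i B₊` is the disjoint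
union of the cosets `R_i(q) B₊` (`exists_rMat_of_mem_borelPos`, `rMat_inj`), the remaining flags
are given by unique coordinates, and general position at the end of the chain says that `M(q)` lies
in the big cell (`CoordCell.toConf_bijective`).  All of this holds over any commutative ring.

*Augmentations.*  The immersed disks are enumerated by sweeping a vertical line over the diagram of
the rainbow closure.  A piece of a disk to the right of a cut can only be the inside of a right cap
(`Piece.exists_rightCap`), so only the pieces to the left of a cut matter.  In the braid, these are
bounded by one of the `n` upper strands and one of the `n` lower ones, and the sums of their words
form an `n × n` matrix.  Passing the crossing `b_k` multiplies this matrix by `R_{i_k}(b_k)`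
(`sumsTo_braid`; signs are irrelevant in characteristic two), so the end of the braid is reached
with the matrix `M(b)`.  At the right cusps, the pieces may merge around the caps, and passing a
cusp is a step of Gaussian elimination (`sumsTo_cusps`, `schur`).  The differential of the chord
`a_k` is the `k`-th pivot plus `t_k⁻¹` (`map_chordDiff_cusp`), and the chords of the braid are cycles
(`map_chordDiff_braid`).  Hence an augmentation is a tuple `b` for which the elimination succeeds,
with pivots `t_k⁻¹`, that is, one for which `M(b)` lies in the big cell
(`inBigCell_of_pivots`, `exists_pivots`), and the `t_k` are determined by `b`.

*Braid moves.*  The given formulas for the Reeb coordinates leave `M`, and all partial products that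
do not end inside the move, unchanged (`BraidMove.partialProd_reeb`, which rests on `rMat_comm` and
`rMat_braid`).  On the other side, the flags strictly inside a move are determined by their
neighbours (`Collection.eq_of_not_inner`), so that both correspondences become the same bijection
of the coordinates.
-/

/-! ### Words of a braid are connected by braid moves -/

section Moves

variable {n : ℕ}

/-- The concatenation of two sequences of braid moves. -/
def MovePath.trans {w w' w'' : BraidWord n} : MovePath w w' → MovePath w' w'' → MovePath w w''
  | .nil _, q => q
  | .cons m p, q => .cons m (p.trans q)

/-- The inverse of a braid move, which is again a braid move. -/
def BraidMove.symm {w w' : BraidWord n} : BraidMove w w' → BraidMove w' w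
  | .comm a z i j h => .comm a z j i h.symm
  | .braid a z i j h => .braid a z j i h.symm

/-- The sequence of the inverse moves, in the opposite order. -/
def MovePath.symm {w w' : BraidWord n} : MovePath w w' → MovePath w' w
  | .nil w => .nil w
  | .cons m p => p.symm.trans (.cons m.symm (.nil _))

lemma BraidMove.nonempty_extend {w w' : BraidWord n} (m : BraidMove w w') (u v : BraidWord n) :
    Nonempty (BraidMove (u ++ w ++ v) (u ++ w' ++ v)) := by
  cases m with
  | comm a z i j h =>
    simpa [List.append_assoc] using Nonempty.intro (BraidMove.comm (u ++ a) (z ++ v) i j h)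
  | braid a z i j h =>
    simpa [List.append_assoc] using Nonempty.intro (BraidMove.braid (u ++ a) (z ++ v) i j h)

lemma MovePath.nonempty_extend {w w' : BraidWord n} (p : MovePath w w') (u v : BraidWord n) :
    Nonempty (MovePath (u ++ w ++ v) (u ++ w' ++ v)) := by
  induction p with
  | nil w => exact ⟨.nil _⟩
  | cons m p ih =>
    obtain ⟨m'⟩ := m.nonempty_extend u v
    obtain ⟨p'⟩ := ih
    exact ⟨.cons m' p'⟩

/-- The congruence on words generated by the braid relations is reachability by braid moves. -/
lemma nonempty_movePath_of_conGen {x y : FreeMonoid (Fin (n - 1))}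
    (h : conGen (BraidRel n) x y) : Nonempty (MovePath x.toList y.toList) := by
  let c : Con (FreeMonoid (Fin (n - 1))) :=
    { r := fun x y => Nonempty (MovePath (n := n) x.toList y.toList)
      iseqv := ⟨fun _ => ⟨.nil _⟩, fun ⟨p⟩ => ⟨p.symm⟩, fun ⟨p⟩ ⟨q⟩ => ⟨p.trans q⟩⟩
      mul' := by
        rintro a b x y ⟨p⟩ ⟨q⟩
        obtain ⟨p'⟩ := p.nonempty_extend [] x.toList
        obtain ⟨q'⟩ := q.nonempty_extend b.toList []
        exact ⟨MovePath.trans (by simpa using p') (by simpa using q')⟩ }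
  have hc : conGen (BraidRel n) ≤ c := by
    refine Con.conGen_le.2 ?_
    intro a b hab
    cases hab with
    | comm i j h => exact ⟨.cons (.comm [] [] i j (Or.inl h)) (.nil _)⟩
    | braid i j h => exact ⟨.cons (.braid [] [] i j (Or.inl h)) (.nil _)⟩
  exact hc h

lemma nonempty_movePath {β : PosBraid n} (w w' : β.Word) : Nonempty (MovePath w.1 w'.1) :=
  nonempty_movePath_of_conGen (PresentedMonoid.mk_eq_mk_iff.1 (w.2.trans w'.2.symm))

end Moves

/-! ### Elementary matrices and relative positions of flags -/

section Matrices

open Matrix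

variable {n : ℕ} {R : Type u} [CommRing R]

lemma rowLo_ne_rowHi (i : Fin (n - 1)) : rowLo i ≠ rowHi i := by
  simp [rowLo, rowHi, Fin.ext_iff]

lemma blockMatrix_mul_apply (i : Fin (n - 1)) (A : Matrix (Fin 2) (Fin 2) R)
    (N : Matrix (Fin n) (Fin n) R) (r c : Fin n) :
    (blockMatrix i A * N) r c =
      if r = rowLo i then A 0 0 * N (rowLo i) c + A 0 1 * N (rowHi i) c
      else if r = rowHi i then A 1 0 * N (rowLo i) c + A 1 1 * N (rowHi i) c
      else N r c := by
  have hne := rowLo_ne_rowHi i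
  have key : ∀ x y : R, ∑ b, (if b = rowLo i then x else if b = rowHi i then y else 0) * N b c =
      x * N (rowLo i) c + y * N (rowHi i) c := by
    intro x y
    rw [Fintype.sum_eq_add (rowLo i) (rowHi i) hne]
    · simp [hne.symm]
    · rintro b ⟨h1, h2⟩
      simp [h1, h2]
  rw [Matrix.mul_apply]
  unfold blockMatrix
  split_ifs with h1 h2
  · exact key _ _
  · exact key _ _
  · simp

lemma mul_blockMatrix_apply (i : Fin (n - 1)) (A : Matrix (Fin 2) (Fin 2) R)
    (N : Matrix (Fin n) (Fin n) R) (r c : Fin n) :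
    (N * blockMatrix i A) r c =
      if c = rowLo i then N r (rowLo i) * A 0 0 + N r (rowHi i) * A 1 0
      else if c = rowHi i then N r (rowLo i) * A 0 1 + N r (rowHi i) * A 1 1
      else N r c := by
  have hT : (blockMatrix i A)ᵀ = blockMatrix i Aᵀ := by
    have hne := rowLo_ne_rowHi i
    ext a b
    simp only [Matrix.transpose_apply, blockMatrix]
    grind
  have h := blockMatrix_mul_apply i Aᵀ Nᵀ c r
  rw [← hT, ← Matrix.transpose_mul] at h
  simpa only [Matrix.transpose_apply, mul_comm] using h

lemma blockMatrix_mul_blockMatrix (i : Fin (n - 1)) (A B : Matrix (Fin 2) (Fin 2) R) :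
    blockMatrix i A * blockMatrix i B = blockMatrix i (A * B) := by
  have hne := rowLo_ne_rowHi i
  ext r c
  rw [blockMatrix_mul_apply]
  simp only [blockMatrix, Matrix.mul_apply, Fin.sum_univ_two]
  split_ifs <;> simp_all

lemma coe_rMat (i : Fin (n - 1)) (q : R) :
    (rMat i q).1 = blockMatrix i !![q, -1; 1, 0] := by
  change blockMatrix i !![1, q; 0, 1] * blockMatrix i !![0, -1; 1, 0] = _
  rw [blockMatrix_mul_blockMatrix]
  simp

lemma rMat_mul_apply (i : Fin (n - 1)) (q : R) (g : SpecialLinearGroup (Fin n) R) (r c : Fin n) :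
    (rMat i q * g) r c =
      if r = rowLo i then q * g (rowLo i) c - g (rowHi i) c
      else if r = rowHi i then g (rowLo i) c else g r c := by
  change ((rMat i q).1 * g.1) r c = _
  rw [coe_rMat, blockMatrix_mul_apply]
  simp [sub_eq_add_neg]

lemma mul_rMat_apply (i : Fin (n - 1)) (q : R) (g : SpecialLinearGroup (Fin n) R) (r c : Fin n) :
    (g * rMat i q) r c =
      if c = rowLo i then g r (rowLo i) * q + g r (rowHi i)
      else if c = rowHi i then - g r (rowLo i) else g r c := by
  change (g.1 * (rMat i q).1) r c = _
  rw [coe_rMat, mul_blockMatrix_apply]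
  simp

lemma specialLinearGroup_one_apply (r c : Fin n) :
    (1 : SpecialLinearGroup (Fin n) R) r c = if r = c then 1 else 0 := rfl

lemma rMat_comm (i j : Fin (n - 1)) (h : (i : ℕ) + 2 ≤ j ∨ (j : ℕ) + 2 ≤ i) (a b : R) :
    rMat i a * rMat j b = rMat j b * rMat i a := by
  ext r c
  have h1 : rowLo i ≠ rowLo j := by simp only [rowLo, ne_eq, Fin.mk.injEq]; omega
  have h2 : rowLo i ≠ rowHi j := by simp only [rowLo, rowHi, ne_eq, Fin.mk.injEq]; omega
  have h3 : rowHi i ≠ rowLo j := by simp only [rowLo, rowHi, ne_eq, Fin.mk.injEq]; omega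
  have h4 : rowHi i ≠ rowHi j := by simp only [rowHi, ne_eq, Fin.mk.injEq]; omega
  rw [← mul_one (rMat i a * rMat j b), ← mul_one (rMat j b * rMat i a), mul_assoc, mul_assoc]
  simp only [rMat_mul_apply, h1, h2, h3, h4, h1.symm, h2.symm, h3.symm, h4.symm, if_false]
  split_ifs <;> simp_all

/-- The braid relation of the matrices `R_i(q)`. -/
lemma rMat_braid_of_succ (i j : Fin (n - 1)) (h : (i : ℕ) + 1 = j) (a b c : R) :
    rMat i a * rMat j b * rMat i c = rMat j c * rMat i (a * c - b) * rMat j a := by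
  have e : rowLo j = rowHi i := by simp [rowLo, rowHi, h]
  have h1 : rowLo i ≠ rowHi i := rowLo_ne_rowHi i
  have h2 : rowLo i ≠ rowHi j := by simp only [rowLo, rowHi, ne_eq, Fin.mk.injEq]; omega
  have h3 : rowHi i ≠ rowHi j := by simp only [rowHi, ne_eq, Fin.mk.injEq]; omega
  ext r s
  rw [← mul_one (rMat i a * rMat j b * rMat i c),
    ← mul_one (rMat j c * rMat i (a * c - b) * rMat j a)]
  simp only [mul_assoc]
  simp only [rMat_mul_apply, e, h1, h2, h3, h1.symm, h2.symm, h3.symm, if_false, if_true]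
  split_ifs <;> first | ring1 | simp_all

lemma rMat_braid (i j : Fin (n - 1)) (h : (i : ℕ) + 1 = j ∨ (j : ℕ) + 1 = i) (a b c : R) :
    rMat i a * rMat j b * rMat i c = rMat j c * rMat i (a * c - b) * rMat j a := by
  rcases h with h | h
  · exact rMat_braid_of_succ i j h a b c
  · have := rMat_braid_of_succ j i h c (a * c - b) a
    rw [this]
    congr 3
    ring

lemma isUnit_diag_of_mem_borelPos {g : SpecialLinearGroup (Fin n) R} (hg : g ∈ borelPos n R)
    (a : Fin n) : IsUnit (g a a) := by
  have h : g.1.det = ∏ i, g.1 i i := Matrix.det_of_isUpperTriangular (fun a b h => hg a b h)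
  rw [g.2] at h
  exact isUnit_of_dvd_one
    ((Finset.dvd_prod_of_mem (fun i => g.1 i i) (Finset.mem_univ a)).trans h.symm.dvd)

lemma isUnit_diag_of_mem_borelNeg {g : SpecialLinearGroup (Fin n) R} (hg : g ∈ borelNeg n R)
    (a : Fin n) : IsUnit (g a a) := by
  have h : g.1.det = ∏ i, g.1 i i := Matrix.det_of_isLowerTriangular _ (fun a b h => hg a b h)
  rw [g.2] at h
  exact isUnit_of_dvd_one
    ((Finset.dvd_prod_of_mem (fun i => g.1 i i) (Finset.mem_univ a)).trans h.symm.dvd)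

lemma rootElt_mem_borelPos (i : Fin (n - 1)) (q : R) : rootElt i q ∈ borelPos n R := by
  intro a b h
  have hne := rowLo_ne_rowHi i
  have hlt : rowLo i < rowHi i := by simp [rowLo, rowHi, Fin.lt_def]
  change blockMatrix i !![1, q; 0, 1] a b = 0
  unfold blockMatrix
  split_ifs with h1 h2 h3 h4 h5 h6 <;> subst_vars <;> simp_all [not_lt_of_gt]

/-- Every element of `B₊ s_i B₊` lies in `R_i(q) B₊` for some `q`. -/
lemma exists_rMat_of_mem_borelPos (i : Fin (n - 1)) {b : SpecialLinearGroup (Fin n) R}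
    (hb : b ∈ borelPos n R) : ∃ q : R, (rMat i q)⁻¹ * (b * sBar R i) ∈ borelPos n R := by
  obtain ⟨d, hd⟩ := (isUnit_diag_of_mem_borelPos hb (rowHi i)).exists_right_inv
  -- `q` is chosen so that `e_i(-q) b` has the entry `0` in the row `i` and the column `i + 1`
  refine ⟨b (rowLo i) (rowHi i) * d, ?_⟩
  set q := b (rowLo i) (rowHi i) * d with hq
  have hinv : (rMat i q)⁻¹ = rootMap i ⟨!![0, 1; -1, q], by simp⟩ := by
    refine inv_eq_of_mul_eq_one_right (Subtype.ext ?_)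
    change (rMat i q).1 * blockMatrix i !![0, 1; -1, q] = 1
    rw [coe_rMat, blockMatrix_mul_blockMatrix]
    ext r c
    have hne := rowLo_ne_rowHi i
    simp only [blockMatrix, Matrix.one_apply]
    split_ifs <;> simp_all
  rw [hinv]
  have hne := rowLo_ne_rowHi i
  have hlt : rowLo i < rowHi i := by simp [rowLo, rowHi, Fin.lt_def]
  have hcov : ∀ c : Fin n, c < rowHi i → c ≠ rowLo i → c < rowLo i := by
    intro c h1 h2
    simp only [rowLo, rowHi, Fin.lt_def, ne_eq, Fin.ext_iff] at *
    omega
  have hcov' : ∀ c : Fin n, rowLo i < c → c ≠ rowHi i → rowHi i < c := by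
    intro c h1 h2
    simp only [rowLo, rowHi, Fin.lt_def, ne_eq, Fin.ext_iff] at *
    omega
  have hb' : ∀ r c, (b * sBar R i) r c = if c = rowLo i then b r (rowHi i)
      else if c = rowHi i then - b r (rowLo i) else b r c := by
    intro r c
    change (b.1 * blockMatrix i !![(0 : R), -1; 1, 0] : Matrix _ _ R) r c = _
    rw [mul_blockMatrix_apply]
    simp
  intro r c hrc
  change (blockMatrix i !![0, 1; -1, q] * (b * sBar R i).1) r c = 0
  rw [blockMatrix_mul_apply]
  simp only [Matrix.of_apply, Matrix.cons_val', Matrix.cons_val_zero, Matrix.cons_val_one,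
    Matrix.cons_val_fin_one, zero_mul, one_mul, zero_add, neg_mul]
  simp only [hb']
  by_cases h1 : r = rowLo i
  · subst h1
    simp [hrc.ne, (hrc.trans hlt).ne, hb _ _ (hrc.trans hlt)]
  by_cases h2 : r = rowHi i
  · subst h2
    by_cases h3 : c = rowLo i
    · subst h3
      rw [if_neg hne.symm, if_pos rfl, if_pos rfl, if_pos rfl, hq]
      linear_combination (b (rowLo i) (rowHi i)) * hd
    · simp [hne.symm, h3, hrc.ne, hb _ _ hrc, hb _ _ (hcov c hrc h3)]
  · rw [if_neg h1, if_neg h2]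
    split_ifs with h3 h4
    · exact hb _ _ (hcov' r (h3 ▸ hrc) h2)
    · rw [hb _ _ (hlt.trans (h4 ▸ hrc)), neg_zero]
    · exact hb _ _ hrc

/-- `R_i(q) B₊` determines `q`. -/
lemma rMat_inj {i : Fin (n - 1)} {q q' : R} {u : SpecialLinearGroup (Fin n) R}
    (hu : u ∈ borelPos n R) (h : rMat i q * u = rMat i q') : q = q' := by
  have hlt : rowLo i < rowHi i := by simp [rowLo, rowHi, Fin.lt_def]
  have h' : ∀ r c, (rMat i q * u) r c = (rMat i q' * 1) r c := by simp [h]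
  have h1 := h' (rowHi i) (rowLo i)
  have h2 := h' (rowLo i) (rowLo i)
  simp only [rMat_mul_apply, hlt.ne, hlt.ne', if_true, if_false] at h1 h2
  simpa [h1, hu _ _ hlt, hlt.ne'] using h2

/-- In a chain `B₊ → R_i(a) B₊ → R_i(a) R_j(b) B₊` with commuting letters the flag in the middle is
determined by the outer ones. -/
lemma rMat_comm_inj {i j : Fin (n - 1)} (hij : (i : ℕ) + 2 ≤ j ∨ (j : ℕ) + 2 ≤ i) {a b a' b' : R}
    {u : SpecialLinearGroup (Fin n) R} (hu : u ∈ borelPos n R)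
    (h : rMat i a * rMat j b * u = rMat i a' * rMat j b') : a = a' := by
  have hlt : rowLo i < rowHi i := by simp [rowLo, rowHi, Fin.lt_def]
  have h1 : rowLo i ≠ rowLo j := by simp only [rowLo, ne_eq, Fin.mk.injEq]; omega
  have h2 : rowLo i ≠ rowHi j := by simp only [rowLo, rowHi, ne_eq, Fin.mk.injEq]; omega
  have h3 : rowHi i ≠ rowLo j := by simp only [rowLo, rowHi, ne_eq, Fin.mk.injEq]; omega
  have h4 : rowHi i ≠ rowHi j := by simp only [rowHi, ne_eq, Fin.mk.injEq]; omega
  have h' : ∀ r c, (rMat i a * (rMat j b * u)) r c = (rMat i a' * (rMat j b' * 1)) r c := by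
    simp [h, ← mul_assoc]
  have e1 := h' (rowHi i) (rowLo i)
  have e2 := h' (rowLo i) (rowLo i)
  simp only [rMat_mul_apply, hlt.ne, hlt.ne', h1, h2, h3, h4, if_true, if_false] at e1 e2
  simpa [e1, hu _ _ hlt, hlt.ne'] using e2

lemma rMat_braid_inj_of_succ {i j : Fin (n - 1)} (hij : (i : ℕ) + 1 = j) {a b c a' b' c' : R}
    {u : SpecialLinearGroup (Fin n) R} (hu : u ∈ borelPos n R)
    (h : rMat i a * rMat j b * rMat i c * u = rMat i a' * rMat j b' * rMat i c') :
    a = a' ∧ b = b' ∧ c = c' := by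
  have e : rowLo j = rowHi i := by simp [rowLo, rowHi, hij]
  have h1 : rowLo i < rowHi i := by simp [rowLo, rowHi, Fin.lt_def]
  have h3 : rowHi i < rowHi j := by simp only [rowHi, Fin.mk_lt_mk]; omega
  have h2 := h1.trans h3
  have h' : ∀ r s, (rMat i a * (rMat j b * (rMat i c * u))) r s =
      (rMat i a' * (rMat j b' * (rMat i c' * 1))) r s := by
    simp [h, ← mul_assoc]
  -- compare the entries in the rows `i + 2, i + 1, i` and the columns `i, i + 1`
  have x1 := h' (rowHi j) (rowLo i)
  have x2 := h' (rowHi j) (rowHi i)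
  have y1 := h' (rowHi i) (rowLo i)
  have y2 := h' (rowHi i) (rowHi i)
  have z1 := h' (rowLo i) (rowLo i)
  have z2 := h' (rowLo i) (rowHi i)
  simp only [rMat_mul_apply, e, h1.ne, h1.ne', h2.ne, h2.ne', h3.ne, h3.ne', if_true, if_false,
    hu _ _ h1, hu _ _ h2, hu _ _ h3, specialLinearGroup_one_apply] at x1 x2 y1 y2 z1 z2
  rw [x1] at y1 z1
  rw [x2] at y2 z2
  have hc : c = c' := by linear_combination y1
  have ha : a = a' := by linear_combination -z2 + a * y2
  refine ⟨ha, ?_, hc⟩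
  subst hc ha
  linear_combination -z1

/-- The braid relation analogue of `rMat_comm_inj`: the flags inside a chain
`B₊ → R_i(a) B₊ → R_i(a) R_j(b) B₊ → R_i(a) R_j(b) R_i(c) B₊` are determined by the outer ones. -/
lemma rMat_braid_inj {i j : Fin (n - 1)} (hij : (i : ℕ) + 1 = j ∨ (j : ℕ) + 1 = i)
    {a b c a' b' c' : R} {u : SpecialLinearGroup (Fin n) R} (hu : u ∈ borelPos n R)
    (h : rMat i a * rMat j b * rMat i c * u = rMat i a' * rMat j b' * rMat i c') :
    a = a' ∧ b = b' ∧ c = c' := by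
  rcases hij with hij | hij
  · exact rMat_braid_inj_of_succ hij hu h
  · rw [rMat_braid i j (Or.inr hij), rMat_braid i j (Or.inr hij)] at h
    obtain ⟨rfl, h2, rfl⟩ := rMat_braid_inj_of_succ hij hu h
    exact ⟨rfl, by linear_combination -h2, rfl⟩

end Matrices

/-! ### Gaussian elimination and the big cell -/

section Gauss

open Matrix

variable {n : ℕ} {R : Type u} [CommRing R]

/-- The big cell `B₋ B₊` of `SL_n`. -/
def InBigCell (g : SpecialLinearGroup (Fin n) R) : Prop :=
  ∃ b ∈ borelNeg n R, ∃ b' ∈ borelPos n R, g = b * b'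

/-- The successive remainders of Gaussian elimination on `A` in characteristic two, where `t k` is
the proposed inverse of the pivot number `k`: every step adds the product of the pivot column and
the pivot row, divided by the pivot. -/
def schur (A : ℕ → ℕ → R) (t : ℕ → R) : ℕ → ℕ → ℕ → R
  | 0 => A
  | k + 1 => fun r c => schur A t k r c + schur A t k r k * t k * schur A t k k c

/-- The entries of a matrix of size `n`, extended by zero to all pairs of natural numbers. -/
def entry (g : SpecialLinearGroup (Fin n) R) (r c : ℕ) : R :=
  if h : r < n ∧ c < n then g ⟨r, h.1⟩ ⟨c, h.2⟩ else 0

lemma entry_val (g : SpecialLinearGroup (Fin n) R) (r c : Fin n) : entry g r c = g r c := by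
  simp [entry]

lemma schur_congr (A : ℕ → ℕ → R) {t t' : ℕ → R} {k : ℕ} (h : ∀ j < k, t j = t' j) :
    schur A t k = schur A t' k := by
  induction k with
  | zero => rfl
  | succ k ih =>
    have ih' := ih fun j hj => h j (hj.trans k.lt_succ_self)
    funext r c
    simp only [schur, ih', h k k.lt_succ_self]

/-- The pivots of a Gaussian elimination are determined by the matrix. -/
lemma pivot_unique {A : ℕ → ℕ → R} {t t' : ℕ → R} (n : ℕ)
    (h : ∀ k < n, t k * schur A t k k k = 1) (h' : ∀ k < n, t' k * schur A t' k k k = 1) :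
    ∀ k < n, t k = t' k := by
  intro k
  induction k using Nat.strong_induction_on with
  | _ k ih =>
    intro hk
    have e := schur_congr A fun j hj => ih j hj (hj.trans hk)
    have h1 := h k hk
    have h2 := h' k hk
    rw [e] at h1
    linear_combination t' k * h1 - t k * h2

lemma schur_pivot_eq_zero (h2 : (2 : R) = 0) {A : ℕ → ℕ → R} {t : ℕ → R} {n : ℕ}
    (h : ∀ k < n, t k * schur A t k k k = 1) {k : ℕ} (hk : k ≤ n) {j : ℕ} (hj : j < k) (i : ℕ) :
    schur A t k i j = 0 ∧ schur A t k j i = 0 := by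
  induction k generalizing j i with
  | zero => omega
  | succ k ih =>
    rcases Nat.lt_succ_iff_lt_or_eq.1 hj with hj | rfl
    · have h1 := ih (by omega) hj
      simp [schur, (h1 i).1, (h1 i).2, (h1 k).1, (h1 k).2]
    · have hp := h j (by omega)
      constructor
      · simp only [schur]
        linear_combination schur A t j i j * hp + schur A t j i j * h2
      · simp only [schur]
        linear_combination schur A t j j i * hp + schur A t j j i * h2

lemma schur_add_sum (h2 : (2 : R) = 0) (A : ℕ → ℕ → R) (t : ℕ → R) (m r c : ℕ) :
    A r c = schur A t m r c +
      ∑ k ∈ Finset.range m, schur A t k r k * t k * schur A t k k c := by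
  induction m with
  | zero => simp [schur]
  | succ m ih =>
    rw [Finset.sum_range_succ, ih]
    simp only [schur]
    linear_combination -(schur A t m r m * t m * schur A t m m c) * h2

/-- If Gaussian elimination succeeds, it yields a factorization into triangular matrices. -/
lemma inBigCell_of_pivots (h2 : (2 : R) = 0) {g : SpecialLinearGroup (Fin n) R} {t : ℕ → R}
    (h : ∀ k < n, t k * schur (entry g) t k k k = 1) : InBigCell g := by
  let L : Matrix (Fin n) (Fin n) R := fun r k => schur (entry g) t k r k * t k
  let U : Matrix (Fin n) (Fin n) R := fun k c => schur (entry g) t k k c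
  have hL : ∀ a b : Fin n, a < b → L a b = 0 := fun a b hab => by
    simp [L, (schur_pivot_eq_zero h2 h b.2.le hab b).2]
  have hU : ∀ a b : Fin n, b < a → U a b = 0 := fun a b hab => by
    simp [U, (schur_pivot_eq_zero h2 h a.2.le hab a).1]
  have hLU : g.1 = L * U := by
    ext r c
    have := schur_add_sum h2 (entry g) t n r c
    rw [(schur_pivot_eq_zero h2 h le_rfl r.2 c).2, zero_add, entry_val] at this
    rw [this, Matrix.mul_apply,
      Finset.sum_range fun k => schur (entry g) t k r k * t k * schur (entry g) t k k c]
  have hdL : L.det = 1 := by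
    rw [Matrix.det_of_isLowerTriangular L fun a b hab => hL a b hab]
    exact Finset.prod_eq_one fun k _ => by rw [← h k k.2, mul_comm]
  have hdU : U.det = 1 := by
    have := g.2
    rwa [hLU, Matrix.det_mul, hdL, one_mul] at this
  exact ⟨⟨L, hdL⟩, hL, ⟨U, hdU⟩, hU, Subtype.ext hLU⟩

/-- Gaussian elimination succeeds on the big cell. -/
lemma exists_pivots (h2 : (2 : R) = 0) {g : SpecialLinearGroup (Fin n) R} (hg : InBigCell g) :
    ∃ t : ℕ → R, ∀ k < n, t k * schur (entry g) t k k k = 1 := by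
  obtain ⟨b, hb, b', hb', rfl⟩ := hg
  have hu : ∀ k : Fin n, ∃ d, d * (b k k * b' k k) = 1 := fun k =>
    ((isUnit_diag_of_mem_borelNeg hb k).mul (isUnit_diag_of_mem_borelPos hb' k)).exists_left_inv
  choose d hd using hu
  let t : ℕ → R := fun k => if h : k < n then d ⟨k, h⟩ else 0
  -- the remainder after `k` steps is the product of the triangular factors without the first `k`
  -- columns of the left one and the first `k` rows of the right one
  have key : ∀ k ≤ n, ∀ r c, schur (entry (b * b')) t k r c =
      ∑ m ∈ Finset.Ico k n, entry b r m * entry b' m c := by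
    have hdiag : ∀ m : Fin n, entry b m m = b m m ∧ entry b' m m = b' m m := fun m =>
      ⟨entry_val _ _ _, entry_val _ _ _⟩
    have hlow : ∀ r m, r < m → entry b r m = 0 := fun r m h => by
      unfold entry
      split_ifs with h'
      · exact hb _ _ h
      · rfl
    have hupp : ∀ m c, c < m → entry b' m c = 0 := fun m c h => by
      unfold entry
      split_ifs with h'
      · exact hb' _ _ h
      · rfl
    intro k
    induction k with
    | zero =>
      intro _ r c
      rw [Nat.Ico_zero_eq_range, Finset.sum_range fun m => entry b r m * entry b' m c]
      by_cases h : r < n ∧ c < n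
      · have e : (b * b') ⟨r, h.1⟩ ⟨c, h.2⟩ = ∑ m : Fin n, b ⟨r, h.1⟩ m * b' m ⟨c, h.2⟩ :=
          Matrix.mul_apply (M := b.1) (N := b'.1)
        simp [schur, entry, h, e]
      · refine (dif_neg h).trans (Finset.sum_eq_zero fun m _ => ?_).symm
        rcases not_and_or.1 h with h | h
        · simp [entry, h]
        · simp [entry, h]
    | succ k ih =>
      intro hk r c
      have ih := ih (by omega)
      have hsplit : ∀ f : ℕ → R, ∑ m ∈ Finset.Ico k n, f m =
          f k + ∑ m ∈ Finset.Ico (k + 1) n, f m := fun f =>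
        Finset.sum_eq_sum_Ico_succ_bot hk f
      have hcol : schur (entry (b * b')) t k r k = entry b r k * entry b' k k := by
        rw [ih, hsplit, Finset.sum_eq_zero, add_zero]
        intro m hm
        rw [hupp m k (Finset.mem_Ico.1 hm).1, mul_zero]
      have hrow : schur (entry (b * b')) t k k c = entry b k k * entry b' k c := by
        rw [ih, hsplit, Finset.sum_eq_zero, add_zero]
        intro m hm
        rw [hlow k m (Finset.mem_Ico.1 hm).1, zero_mul]
      have hp : t k * (entry b k k * entry b' k k) = 1 := by
        have h := hd ⟨k, hk⟩
        rw [← (hdiag ⟨k, hk⟩).1, ← (hdiag ⟨k, hk⟩).2] at h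
        simpa [t, show k < n from hk] using h
      simp only [schur]
      rw [hcol, hrow, ih, hsplit]
      linear_combination (entry b r k * entry b' k c) * hp + (entry b r k * entry b' k c) * h2
  refine ⟨t, fun k hk => ?_⟩
  rw [key k hk.le, Finset.sum_eq_single_of_mem k (by simpa using hk)]
  · have h1 := entry_val b ⟨k, hk⟩ ⟨k, hk⟩
    have h2 := entry_val b' ⟨k, hk⟩ ⟨k, hk⟩
    simp only at h1 h2
    simpa [h1, h2, t, hk] using hd ⟨k, hk⟩
  · intro m hm hne
    have : k < m := lt_of_le_of_ne (Finset.mem_Ico.1 hm).1 hne.symm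
    have : entry b k m = 0 := by
      unfold entry
      split_ifs with h'
      · exact hb _ _ this
      · rfl
    rw [this, zero_mul]

lemma InBigCell.map {S : Type u} [CommRing S] (f : R →+* S) {g : SpecialLinearGroup (Fin n) R}
    (hg : InBigCell g) : InBigCell (SpecialLinearGroup.map f g) := by
  obtain ⟨b, hb, b', hb', rfl⟩ := hg
  exact ⟨_, borelNeg_map f hb, _, borelPos_map f hb', map_mul _ _ _⟩

end Gauss

/-! ### Partial products along a braid word -/

section PartialProd

open Matrix

variable {n : ℕ} {R : Type u} [CommRing R]

/-- The factor `R_{i_k}(q_k)` of a word, and the identity beyond the end of the word. -/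
def wordFactor (w : BraidWord n) (q : ℕ → R) (k : ℕ) : SpecialLinearGroup (Fin n) R :=
  (w[k]?).elim 1 fun i => rMat i (q k)

/-- The product of the first `k` factors `R_{i_1}(q_1) ⋯ R_{i_k}(q_k)` of a word. -/
def partialProd (w : BraidWord n) (q : ℕ → R) : ℕ → SpecialLinearGroup (Fin n) R
  | 0 => 1
  | k + 1 => partialProd w q k * wordFactor w q k

/-- A tuple, extended by zero to a sequence. -/
def extendZero {l : ℕ} (q : Fin l → R) (j : ℕ) : R := if h : j < l then q ⟨j, h⟩ else 0

lemma extendZero_val {l : ℕ} (q : Fin l → R) (j : Fin l) : extendZero q j = q j := by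
  simp [extendZero]

lemma wordFactor_of_lt {w : BraidWord n} (q : ℕ → R) {k : ℕ} (h : k < w.length) :
    wordFactor w q k = rMat w[k] (q k) := by
  simp [wordFactor, h]

lemma wordFactor_congr {w w' : BraidWord n} {q q' : ℕ → R} {k : ℕ} (hw : w[k]? = w'[k]?)
    (hq : k < w.length → q k = q' k) : wordFactor w q k = wordFactor w' q' k := by
  unfold wordFactor
  rw [← hw]
  by_cases h : k < w.length
  · rw [hq h]
  · simp [List.getElem?_eq_none (not_lt.1 h)]

lemma partialProd_congr_from {w w' : BraidWord n} {q q' : ℕ → R} {s k : ℕ} (hk : s ≤ k)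
    (hs : partialProd w q s = partialProd w' q' s)
    (h : ∀ j, s ≤ j → wordFactor w q j = wordFactor w' q' j) :
    partialProd w q k = partialProd w' q' k := by
  induction k, hk using Nat.le_induction with
  | base => exact hs
  | succ k hk ih => simp only [partialProd, ih, h k hk]

lemma partialProd_congr {w w' : BraidWord n} {q q' : ℕ → R} {k : ℕ}
    (h : ∀ j < k, wordFactor w q j = wordFactor w' q' j) :
    partialProd w q k = partialProd w' q' k := by
  induction k with
  | zero => rfl
  | succ k ih =>
    simp only [partialProd, ih fun j hj => h j (hj.trans k.lt_succ_self), h k k.lt_succ_self]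

lemma partialProd_congr_coord {w : BraidWord n} {q q' : ℕ → R} (h : ∀ j < w.length, q j = q' j)
    (k : ℕ) : partialProd w q k = partialProd w q' k :=
  partialProd_congr fun j _ => wordFactor_congr rfl (h j)

lemma partialProd_extendZero (w : BraidWord n) (q : Fin w.length → R) (k : ℕ) :
    partialProd w (extendZero q) k =
      ((List.ofFn fun j => rMat (w.get j) (q j)).take k).prod := by
  induction k with
  | zero => rfl
  | succ k ih =>
    rw [List.take_add_one, List.prod_append, ← ih, partialProd]
    congr 1
    rw [List.getElem?_ofFn]
    by_cases h : k < w.length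
    · rw [wordFactor_of_lt _ h]
      simp [h, extendZero]
    · simp [wordFactor, h]

lemma map_rMat {S : Type u} [CommRing S] (f : R →+* S) (i : Fin (n - 1)) (q : R) :
    SpecialLinearGroup.map f (rMat i q) = rMat i (f q) := by
  ext a b
  change f ((rMat i q).1 a b) = (rMat i (f q)).1 a b
  rw [coe_rMat, coe_rMat]
  unfold blockMatrix
  split_ifs <;> simp

lemma map_partialProd {S : Type u} [CommRing S] (f : R →+* S) (w : BraidWord n) (q : ℕ → R)
    (k : ℕ) :
    SpecialLinearGroup.map f (partialProd w q k) = partialProd w (fun j => f (q j)) k := by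
  induction k with
  | zero => exact map_one _
  | succ k ih =>
    rw [partialProd, map_mul, ih, partialProd]
    congr 1
    unfold wordFactor
    cases w[k]? with
    | none => exact map_one _
    | some i => exact map_rMat f i (q k)

lemma comp_extendZero {S : Type u} [CommRing S] (f : R →+* S) {l : ℕ} (q : Fin l → R) :
    (fun j => f (extendZero q j)) = extendZero fun j => f (q j) := by
  funext j
  unfold extendZero
  split_ifs <;> simp

end PartialProd

/-! ### Braid moves and partial products -/

section MoveProd

variable {n : ℕ} {R : Type u} [CommRing R] {w w' : BraidWord n}

lemma BraidMove.length_eq (m : BraidMove w w') : w.length = w'.length := by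
  cases m <;> simp

lemma getElem?_append_of_lt {α : Type*} (a y z : List α) {k : ℕ} (h : k < a.length) :
    (a ++ y)[k]? = (a ++ z)[k]? := by
  rw [List.getElem?_append_left h, List.getElem?_append_left h]

lemma BraidMove.reeb_eq_extendZero (m : BraidMove w w') (q : Fin w.length → R) :
    extendZero (fun k : Fin w'.length => m.reeb (extendZero q) k) = m.reeb (extendZero q) := by
  funext k
  unfold extendZero
  split_ifs with h
  · rfl
  · have hl := m.length_eq
    cases m <;>
      simp only [List.length_append, List.length_cons] at h hl <;>
      simp only [BraidMove.reeb, List.length_append, List.length_cons] <;>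
      split_ifs <;> first | rfl | omega

lemma BraidMove.reeb_symm (h2 : (2 : R) = 0) (m : BraidMove w w') (q : ℕ → R) :
    m.symm.reeb (m.reeb q) = q := by
  funext k
  cases m with
  | comm a z i j h =>
    simp only [BraidMove.symm, BraidMove.reeb]
    split_ifs with h1 h2 <;> first | omega | simp_all
  | braid a z i j h =>
    simp only [BraidMove.symm, BraidMove.reeb]
    split_ifs with h1 h3 h4 <;> first | omega | skip
    all_goals simp_all
    linear_combination q a.length * q (a.length + 2) * h2

/-- The change of Reeb coordinates under a move does not affect the partial products, except for
those that end inside the part of the word where the move takes place. -/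
lemma BraidMove.partialProd_reeb (h2 : (2 : R) = 0) (m : BraidMove w w') (q : ℕ → R) {k : ℕ}
    (hk : ¬ m.Inner k) : partialProd w q k = partialProd w' (m.reeb q) k := by
  cases m with
  | comm a z i j h =>
    have hlt : ∀ s ≤ a.length, partialProd (a ++ i :: j :: z) q s = partialProd
        (a ++ j :: i :: z) ((BraidMove.comm a z i j h).reeb q) s := fun s hs =>
      partialProd_congr fun x hx => wordFactor_congr (getElem?_append_of_lt _ _ _ (by omega))
        fun _ => by
          simp only [BraidMove.reeb]
          rw [if_neg (by omega), if_neg (by omega)]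
    rcases le_or_gt k a.length with hk' | hk'
    · exact hlt k hk'
    have hk2 : a.length + 2 ≤ k := by
      have : k ≠ a.length + 1 := hk
      omega
    refine partialProd_congr_from hk2 ?_ fun x hx => wordFactor_congr ?_ fun _ => ?_
    · simp only [partialProd, hlt _ le_rfl, mul_assoc]
      rw [wordFactor_of_lt _ (by simp), wordFactor_of_lt _ (by simp), wordFactor_of_lt _ (by simp),
        wordFactor_of_lt _ (by simp)]
      simp [BraidMove.reeb, rMat_comm i j h]
    · obtain ⟨y, rfl⟩ := Nat.exists_eq_add_of_le hx
      simp [List.getElem?_append, add_assoc, Nat.add_comm 2 y]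
    · simp only [BraidMove.reeb]
      rw [if_neg (by omega), if_neg (by omega)]
  | braid a z i j h =>
    have hlt : ∀ s ≤ a.length, partialProd (a ++ i :: j :: i :: z) q s = partialProd
        (a ++ j :: i :: j :: z) ((BraidMove.braid a z i j h).reeb q) s := fun s hs =>
      partialProd_congr fun x hx => wordFactor_congr (getElem?_append_of_lt _ _ _ (by omega))
        fun _ => by
          simp only [BraidMove.reeb]
          rw [if_neg (by omega), if_neg (by omega), if_neg (by omega)]
    rcases le_or_gt k a.length with hk' | hk'
    · exact hlt k hk'
    have hk2 : a.length + 3 ≤ k := by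
      have : ¬ (k = a.length + 1 ∨ k = a.length + 2) := hk
      omega
    refine partialProd_congr_from hk2 ?_ fun x hx => wordFactor_congr ?_ fun _ => ?_
    · simp only [partialProd, hlt _ le_rfl]
      rw [wordFactor_of_lt _ (by simp), wordFactor_of_lt _ (by simp), wordFactor_of_lt _ (by simp),
        wordFactor_of_lt _ (by simp), wordFactor_of_lt _ (by simp), wordFactor_of_lt _ (by simp)]
      have e : q a.length * q (a.length + 2) - q (a.length + 1) =
          q (a.length + 1) + q a.length * q (a.length + 2) := by
        linear_combination -q (a.length + 1) * h2
      have := rMat_braid i j h (q a.length) (q (a.length + 1)) (q (a.length + 2))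
      rw [e] at this
      simp only [mul_assoc] at this
      simp [BraidMove.reeb, mul_assoc, this]
    · obtain ⟨y, rfl⟩ := Nat.exists_eq_add_of_le hx
      simp [List.getElem?_append, add_assoc, Nat.add_comm 3 y]
    · simp only [BraidMove.reeb]
      rw [if_neg (by omega), if_neg (by omega), if_neg (by omega)]

lemma BraidMove.not_inner_length (m : BraidMove w w') : ¬ m.Inner w.length := by
  cases m <;> simp [BraidMove.Inner]

end MoveProd

/-! ### Chains of flags in affine coordinates -/

section Chains

open Matrix

variable {n : ℕ} {R : Type u} [CommRing R]

lemma SLFlag.mk_eq_mk {x y : SpecialLinearGroup (Fin n) R} :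
    (x : SLFlag n R) = (y : SLFlag n R) ↔ x⁻¹ * y ∈ borelPos n R := QuotientGroup.eq

lemma DecFlag.mk_eq_mk {x y : SpecialLinearGroup (Fin n) R} :
    DecFlag.mk x = DecFlag.mk y ↔ y * x⁻¹ ∈ unipNeg n R :=
  Quotient.eq.trans QuotientGroup.rightRel_apply

lemma DecFlag.act_mk (g x : SpecialLinearGroup (Fin n) R) :
    (DecFlag.mk x).act g = DecFlag.mk (x * g⁻¹) := rfl

lemma SLFlag.smul_mk (g x : SpecialLinearGroup (Fin n) R) :
    g • (x : SLFlag n R) = ((g * x : SpecialLinearGroup (Fin n) R) : SLFlag n R) := rfl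

/-- The flags in relative position `s_i` to `x B₊` are the `x R_i(q) B₊`. -/
lemma SLFlag.relPos_mk_iff {i : Fin (n - 1)} {x : SpecialLinearGroup (Fin n) R} {B : SLFlag n R} :
    SLFlag.RelPos i (x : SLFlag n R) B ↔
      ∃ q, B = ((x * rMat i q : SpecialLinearGroup (Fin n) R) : SLFlag n R) := by
  constructor
  · rintro ⟨x', y, hx, rfl, b, hb, b', hb', h⟩
    have hu := SLFlag.mk_eq_mk.1 hx.symm
    obtain ⟨q, hq⟩ := exists_rMat_of_mem_borelPos i (mul_mem hu hb)
    refine ⟨q, SLFlag.mk_eq_mk.2 ?_⟩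
    have hy : y = x' * (b * sBar R i * b') := by rw [← h, mul_inv_cancel_left]
    have e : y⁻¹ * (x * rMat i q) = ((rMat i q)⁻¹ * (x⁻¹ * x' * b * sBar R i) * b')⁻¹ := by
      rw [hy]; group
    rw [e]
    exact inv_mem (mul_mem hq hb')
  · rintro ⟨q, rfl⟩
    exact ⟨x, x * rMat i q, rfl, rfl, _, rootElt_mem_borelPos i q, 1, one_mem _, by
      rw [inv_mul_cancel_left, mul_one]; rfl⟩

/-- A flag `y B₊` is in general position with `U₋` if and only if `y` lies in the big cell. -/
lemma generalPosition_one_iff {y : SpecialLinearGroup (Fin n) R} :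
    GeneralPosition (DecFlag.mk 1) (y : SLFlag n R) ↔ InBigCell y := by
  constructor
  · rintro ⟨x, y', hx, hy, b, hb, b', hb', h⟩
    have hx := inv_mem (DecFlag.mk_eq_mk.1 hx)
    have hy := SLFlag.mk_eq_mk.1 hy
    rw [one_mul, inv_inv] at hx
    refine ⟨x⁻¹ * b, mul_mem (inv_mem hx.1) hb, b' * (y'⁻¹ * y), mul_mem hb' hy, ?_⟩
    rw [← mul_assoc, mul_assoc _ b, ← h]
    group
  · rintro ⟨b, hb, b', hb', rfl⟩
    exact ⟨1, _, rfl, rfl, b, hb, b', hb', one_mul _⟩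

lemma SLFlag.RelPos.smul {i : Fin (n - 1)} {B B' : SLFlag n R} (h : B.RelPos i B')
    (g : SpecialLinearGroup (Fin n) R) : (g • B).RelPos i (g • B') := by
  obtain ⟨x, y, rfl, rfl, h⟩ := h
  refine ⟨g * x, g * y, rfl, rfl, ?_⟩
  simpa [mul_assoc] using h

lemma GeneralPosition.act {A : DecFlag n R} {B : SLFlag n R} (h : GeneralPosition A B)
    (g : SpecialLinearGroup (Fin n) R) : GeneralPosition (A.act g) (g • B) := by
  obtain ⟨x, y, rfl, rfl, h⟩ := h
  refine ⟨x * g⁻¹, g * y, rfl, rfl, ?_⟩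
  simpa [mul_assoc] using h

variable {w : BraidWord n}

/-- The action of the group on collections. -/
def Collection.act (g : SpecialLinearGroup (Fin n) R) (X : Collection w R) : Collection w R where
  top := X.top.act g
  flag k := g • X.flag k
  step k := (X.step k).smul g
  gen_left := X.gen_left.act g
  gen_right := X.gen_right.act g

lemma Conf.mk_act (g : SpecialLinearGroup (Fin n) R) (X : Collection w R) :
    Conf.mk (X.act g) = Conf.mk X :=
  Eq.symm (Quotient.sound ⟨g, rfl, fun _ => rfl⟩)

lemma Conf.mk_eq_mk {X Y : Collection w R} : Conf.mk X = Conf.mk Y ↔ ∃ g, X.act g = Y := by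
  refine ⟨fun h => ?_, ?_⟩
  · obtain ⟨g, h1, h2⟩ := Quotient.exact h
    exact ⟨g, Collection.ext h1 (funext h2)⟩
  · rintro ⟨g, rfl⟩
    exact (Conf.mk_act g X).symm

/-- The collection with the affine coordinates `q`. -/
def coordCollection (w : BraidWord n) (q : ℕ → R) (h : InBigCell (partialProd w q w.length)) :
    Collection w R where
  top := DecFlag.mk 1
  flag k := (partialProd w q k : SLFlag n R)
  step k := SLFlag.relPos_mk_iff.2 ⟨q k, by
    rw [Fin.val_succ, partialProd, wordFactor_of_lt q k.2]; rfl⟩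
  gen_left := generalPosition_one_iff.2 ⟨1, one_mem _, 1, one_mem _, (mul_one _).symm⟩
  gen_right := generalPosition_one_iff.2 h

/-- Every collection can be moved to one that starts with `U₋` and `B₊`. -/
lemma Collection.exists_act_normal (X : Collection w R) :
    ∃ g, (X.act g).top = DecFlag.mk 1 ∧
      (X.act g).flag 0 = ((1 : SpecialLinearGroup (Fin n) R) : SLFlag n R) := by
  obtain ⟨x, y, hx, hy, b, hb, b', hb', h⟩ := X.gen_left
  -- the diagonal part of `b` has to be moved to the other side, to obtain `x y ∈ U₋ B₊`
  let d : Fin n → R := fun a => b a a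
  have hdet : (Matrix.diagonal d).det = 1 := by
    have h := Matrix.det_of_isLowerTriangular b.1 fun a c hac => hb a c hac
    rw [b.2] at h
    rw [Matrix.det_diagonal, h]
  let D : SpecialLinearGroup (Fin n) R := ⟨Matrix.diagonal d, hdet⟩
  have hDn : D ∈ borelNeg n R := fun a c hac => Matrix.diagonal_apply_ne _ hac.ne
  have hDp : D ∈ borelPos n R := fun a c hac => Matrix.diagonal_apply_ne _ hac.ne'
  have hU : b * D⁻¹ ∈ unipNeg n R := by
    refine ⟨mul_mem hb (inv_mem hDn), fun a => ?_⟩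
    have h1 := borelNeg_diag_mul hDn (inv_mem hDn) a
    rw [mul_inv_cancel] at h1
    rw [borelNeg_diag_mul hb (inv_mem hDn)]
    have h2 : D a a = b a a := Matrix.diagonal_apply_eq _ _
    rw [← h2, ← h1]
    simp
  refine ⟨D * b⁻¹ * x, ?_, ?_⟩
  · change X.top.act _ = _
    rw [← hx, DecFlag.act_mk, DecFlag.mk_eq_mk]
    have e : 1 * (x * (D * b⁻¹ * x)⁻¹)⁻¹ = (b * D⁻¹)⁻¹ := by group
    rw [e]
    exact inv_mem hU
  · change _ • X.flag 0 = _
    rw [← hy, SLFlag.smul_mk, SLFlag.mk_eq_mk]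
    have e : (D * b⁻¹ * x * y)⁻¹ * 1 = (D * b')⁻¹ := by
      rw [mul_assoc _ x y, h]; group
    rw [e]
    exact inv_mem (mul_mem hDp hb')

/-- The flags of a chain that starts with `B₊` have coordinates. -/
lemma Collection.exists_coords (X : Collection w R)
    (h0 : X.flag 0 = ((1 : SpecialLinearGroup (Fin n) R) : SLFlag n R)) :
    ∃ q : ℕ → R, ∀ k, X.flag k = (partialProd w q k : SLFlag n R) := by
  suffices H : ∀ m ≤ w.length, ∃ q : ℕ → R, ∀ k : Fin (w.length + 1), (k : ℕ) ≤ m →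
      X.flag k = (partialProd w q k : SLFlag n R) by
    obtain ⟨q, hq⟩ := H _ le_rfl
    exact ⟨q, fun k => hq k (Nat.lt_succ_iff.1 k.2)⟩
  intro m
  induction m with
  | zero =>
    refine fun _ => ⟨0, fun k hk => ?_⟩
    obtain rfl : k = 0 := Fin.ext (Nat.le_zero.1 hk)
    exact h0
  | succ m ih =>
    intro hm
    obtain ⟨q, hq⟩ := ih (by omega)
    have hs := X.step ⟨m, hm⟩
    rw [hq _ le_rfl] at hs
    obtain ⟨p, hp⟩ := SLFlag.relPos_mk_iff.1 hs
    have hcongr : ∀ k ≤ m, partialProd w (Function.update q m p) k = partialProd w q k :=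
      fun k hk => partialProd_congr fun j hj => wordFactor_congr rfl fun _ =>
        Function.update_of_ne (by omega) _ _
    refine ⟨Function.update q m p, fun k hk => ?_⟩
    rcases Nat.le_succ_iff.1 hk with hk | hk
    · rw [hcongr _ hk, hq k hk]
    · obtain rfl : k = Fin.succ ⟨m, hm⟩ := Fin.ext hk
      rw [hp, Fin.val_succ, partialProd, wordFactor_of_lt _ hm, Function.update_self,
        hcongr _ le_rfl]
      rfl

/-- The flags of a chain determine its coordinates. -/
lemma coords_unique {q q' : ℕ → R}
    (h : ∀ k ≤ w.length, (partialProd w q k : SLFlag n R) = (partialProd w q' k : SLFlag n R)) :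
    ∀ j < w.length, q j = q' j := by
  intro j
  induction j using Nat.strong_induction_on with
  | _ j ih =>
    intro hj
    have e : partialProd w q j = partialProd w q' j := partialProd_congr fun x hx =>
      wordFactor_congr rfl fun hxl => ih x hx hxl
    have h1 := SLFlag.mk_eq_mk.1 (h (j + 1) hj)
    simp only [partialProd, wordFactor_of_lt _ hj, e] at h1
    refine rMat_inj (i := w[j]) h1 ?_
    group

lemma unipNeg_inter_borelPos {g : SpecialLinearGroup (Fin n) R} (h : g ∈ unipNeg n R)
    (h' : g ∈ borelPos n R) : g = 1 := by
  ext a b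
  rcases lt_trichotomy a b with hab | rfl | hab
  · rw [h.1 a b hab]; simp [hab.ne]
  · rw [h.2 a]; simp
  · rw [h' a b hab]; simp [hab.ne']

/-- Two collections in the same orbit that start with `U₋` and `B₊` are equal. -/
lemma Collection.eq_of_normal {X Y : Collection w R} (h : Conf.mk X = Conf.mk Y)
    (hX : X.top = DecFlag.mk 1) (hY : Y.top = DecFlag.mk 1)
    (hX' : X.flag 0 = ((1 : SpecialLinearGroup (Fin n) R) : SLFlag n R))
    (hY' : Y.flag 0 = ((1 : SpecialLinearGroup (Fin n) R) : SLFlag n R)) : X = Y := by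
  obtain ⟨g, rfl⟩ := Conf.mk_eq_mk.1 h
  have h1 : X.top.act g = _ := hY
  have h2 : g • X.flag 0 = _ := hY'
  rw [hX, DecFlag.act_mk, DecFlag.mk_eq_mk] at h1
  rw [hX', SLFlag.smul_mk, SLFlag.mk_eq_mk] at h2
  have hg : g = 1 := unipNeg_inter_borelPos (by simpa using h1) (by simpa using inv_mem h2)
  subst hg
  exact Collection.ext (DecFlag.act_one _).symm (funext fun k => (one_smul _ _).symm)

/-- The flag in the middle of a chain with two commuting letters is determined by the outer ones. -/
lemma SLFlag.middle_unique {i j : Fin (n - 1)} (hij : (i : ℕ) + 2 ≤ j ∨ (j : ℕ) + 2 ≤ i)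
    {A B B' C : SLFlag n R} (h1 : A.RelPos i B) (h2 : B.RelPos j C) (h1' : A.RelPos i B')
    (h2' : B'.RelPos j C) : B = B' := by
  induction A using Quotient.inductionOn with
  | h x =>
    change SLFlag.RelPos i (x : SLFlag n R) B at h1
    change SLFlag.RelPos i (x : SLFlag n R) B' at h1'
    obtain ⟨a, rfl⟩ := SLFlag.relPos_mk_iff.1 h1
    obtain ⟨a', rfl⟩ := SLFlag.relPos_mk_iff.1 h1'
    obtain ⟨b, rfl⟩ := SLFlag.relPos_mk_iff.1 h2
    obtain ⟨b', h⟩ := SLFlag.relPos_mk_iff.1 h2'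
    rw [rMat_comm_inj (a := a) (b := b) (a' := a') (b' := b') hij (SLFlag.mk_eq_mk.1 h) (by group)]

/-- The two flags inside a chain with the letters `i, j, i`, where `|i - j| = 1`, are determined by
the outer ones. -/
lemma SLFlag.middle_unique_braid {i j : Fin (n - 1)} (hij : (i : ℕ) + 1 = j ∨ (j : ℕ) + 1 = i)
    {A B B' C C' D : SLFlag n R} (h1 : A.RelPos i B) (h2 : B.RelPos j C) (h3 : C.RelPos i D)
    (h1' : A.RelPos i B') (h2' : B'.RelPos j C') (h3' : C'.RelPos i D) : B = B' ∧ C = C' := by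
  induction A using Quotient.inductionOn with
  | h x =>
    change SLFlag.RelPos i (x : SLFlag n R) B at h1
    change SLFlag.RelPos i (x : SLFlag n R) B' at h1'
    obtain ⟨a, rfl⟩ := SLFlag.relPos_mk_iff.1 h1
    obtain ⟨a', rfl⟩ := SLFlag.relPos_mk_iff.1 h1'
    obtain ⟨b, rfl⟩ := SLFlag.relPos_mk_iff.1 h2
    obtain ⟨b', rfl⟩ := SLFlag.relPos_mk_iff.1 h2'
    obtain ⟨c, rfl⟩ := SLFlag.relPos_mk_iff.1 h3
    obtain ⟨c', h⟩ := SLFlag.relPos_mk_iff.1 h3'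
    obtain ⟨rfl, rfl, -⟩ := rMat_braid_inj (a := a) (b := b) (c := c) (a' := a') (b' := b')
      (c' := c') hij (SLFlag.mk_eq_mk.1 h) (by group)
    exact ⟨rfl, rfl⟩

/-- The step of a collection at a letter, with positions given as natural numbers. -/
lemma Collection.relPos_of_getElem? (X : Collection w R) {k : ℕ} {i : Fin (n - 1)}
    (h : w[k]? = some i) (hk : k < w.length + 1) (hk' : k + 1 < w.length + 1) :
    (X.flag ⟨k, hk⟩).RelPos i (X.flag ⟨k + 1, hk'⟩) := by
  obtain ⟨hlt, rfl⟩ := List.getElem?_eq_some_iff.1 h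
  exact X.step ⟨k, hlt⟩

/-- A collection is determined by its flags outside the part of the chain that a braid move
produces. -/
lemma Collection.eq_of_not_inner {w₀ : BraidWord n} (m : BraidMove w₀ w) {X Y : Collection w R}
    (htop : X.top = Y.top)
    (h : ∀ (k : ℕ) (hk : k < w.length + 1), ¬ m.Inner k → X.flag ⟨k, hk⟩ = Y.flag ⟨k, hk⟩) :
    X = Y := by
  refine Collection.ext htop (funext fun ⟨k, hk⟩ => ?_)
  by_cases hin : m.Inner k
  swap
  · exact h k hk hin
  cases m with
  | comm a z i j hij =>
    obtain rfl : k = a.length + 1 := hin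
    have g1 : (a ++ j :: i :: z)[a.length]? = some j := by simp
    have g2 : (a ++ j :: i :: z)[a.length + 1]? = some i := by simp
    have l2 : a.length + 1 + 1 < (a ++ j :: i :: z).length + 1 := by simp
    have e0 := h a.length (by omega) (by simp [BraidMove.Inner])
    have e2 := h (a.length + 1 + 1) l2 (by simp [BraidMove.Inner])
    refine SLFlag.middle_unique hij.symm (X.relPos_of_getElem? g1 (by omega) hk)
      (X.relPos_of_getElem? g2 hk l2) ?_ ?_
    · rw [e0]; exact Y.relPos_of_getElem? g1 _ _
    · rw [e2]; exact Y.relPos_of_getElem? g2 _ _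
  | braid a z i j hij =>
    have g1 : (a ++ j :: i :: j :: z)[a.length]? = some j := by simp
    have g2 : (a ++ j :: i :: j :: z)[a.length + 1]? = some i := by simp
    have g3 : (a ++ j :: i :: j :: z)[a.length + 1 + 1]? = some j := by
      simp [add_assoc]
    have l3 : a.length + 1 + 1 + 1 < (a ++ j :: i :: j :: z).length + 1 := by
      simp only [List.length_append, List.length_cons]
      omega
    have e0 := h a.length (by omega) (by simp [BraidMove.Inner])
    have e3 := h (a.length + 1 + 1 + 1) l3 (by simp only [BraidMove.Inner]; omega)
    have := SLFlag.middle_unique_braid hij.symm (X.relPos_of_getElem? g1 (by omega) (by omega))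
      (X.relPos_of_getElem? g2 (by omega) (by omega)) (X.relPos_of_getElem? g3 (by omega) l3)
      (by rw [e0]; exact Y.relPos_of_getElem? g1 _ (by omega))
      (Y.relPos_of_getElem? g2 _ (by omega))
      (by rw [e3]; exact Y.relPos_of_getElem? g3 _ _)
    obtain rfl | rfl : k = a.length + 1 ∨ k = a.length + 2 := hin
    · exact this.1
    · exact this.2

end Chains

/-! ### The double Bott–Samelson cell as an open subvariety of affine space -/

section CoordCell

variable {n : ℕ}

/-- The tuples `q` such that `R_{i_1}(q_1) ⋯ R_{i_l}(q_l)` lies in the big cell `B₋ B₊`. -/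
@[ext]
structure CoordCell (w : BraidWord n) (R : Type u) [CommRing R] : Type u where
  /-- the tuple -/
  coord : Fin w.length → R
  mem : InBigCell (partialProd w (extendZero coord) w.length)

/-- Base change of points of `CoordCell`. -/
def CoordCell.map {w : BraidWord n} {R S : Type u} [CommRing R] [CommRing S] (f : R →+* S)
    (q : CoordCell w R) : CoordCell w S :=
  ⟨fun k => f (q.coord k), by
    rw [← comp_extendZero, ← map_partialProd]
    exact q.mem.map f⟩

variable {w w' : BraidWord n} {R : Type u} [CommRing R]

/-- The point of the double Bott–Samelson cell with given affine coordinates. -/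
def CoordCell.toConf (q : CoordCell w R) : Conf w R := Conf.mk (coordCollection w _ q.mem)

lemma CoordCell.hasCoords_toConf_iff (q : CoordCell w R) (q' : Fin w.length → R) :
    q.toConf.HasCoords q' ↔ q.coord = q' := by
  constructor
  · rintro ⟨X, hX, htop, hflag⟩
    have h0 : X.flag 0 = ((1 : Matrix.SpecialLinearGroup (Fin n) R) : SLFlag n R) := hflag 0
    have e := Collection.eq_of_normal hX htop rfl h0 rfl
    subst e
    funext j
    have := coords_unique (w := w) (q := extendZero q.coord) (q' := extendZero q') (fun k hk => by
      rw [partialProd_extendZero w q']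
      exact hflag ⟨k, Nat.lt_succ_of_le hk⟩) j j.2
    rwa [extendZero_val, extendZero_val] at this
  · rintro rfl
    exact ⟨_, rfl, rfl, fun k => by rw [← partialProd_extendZero]; rfl⟩

lemma CoordCell.toConf_bijective : Function.Bijective (CoordCell.toConf : CoordCell w R → _) := by
  constructor
  · intro q q' h
    refine CoordCell.ext ((q.hasCoords_toConf_iff q'.coord).1 ?_)
    rw [h]
    exact (q'.hasCoords_toConf_iff _).2 rfl
  · intro c
    induction c using Quotient.inductionOn with
    | h X =>
      obtain ⟨g, htop, h0⟩ := X.exists_act_normal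
      obtain ⟨q, hq⟩ := (X.act g).exists_coords h0
      have hc : ∀ k, partialProd w (extendZero fun k : Fin w.length => q k) k = partialProd w q k :=
        partialProd_congr_coord fun j hj => by simp [extendZero, hj]
      have hcell : InBigCell (partialProd w q w.length) := by
        have := (X.act g).gen_right
        rw [htop, hq] at this
        exact generalPosition_one_iff.1 this
      refine ⟨⟨fun k => q k, by rwa [hc]⟩, (congrArg Conf.mk ?_).trans (Conf.mk_act g X)⟩
      refine Collection.ext htop.symm (funext fun k => ?_)
      exact (congrArg (fun x : Matrix.SpecialLinearGroup (Fin n) R => (x : SLFlag n R))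
        (hc k)).trans (hq k).symm

lemma CoordCell.toConf_map {S : Type u} [CommRing S] (f : R →+* S) (q : CoordCell w R) :
    (q.map f).toConf = Conf.map f q.toConf := by
  refine congrArg Conf.mk (Collection.ext ?_ (funext fun k => ?_))
  · exact congrArg DecFlag.mk (map_one _).symm
  · refine congrArg (fun x : Matrix.SpecialLinearGroup (Fin n) S => (x : SLFlag n S)) ?_
    exact (congrArg (partialProd w · k) (comp_extendZero f q.coord)).symm.trans
      (map_partialProd f w _ k).symm

/-- The effect of a braid move on the coordinates. -/
def BraidMove.cellMap (h2 : (2 : R) = 0) (m : BraidMove w w') (q : CoordCell w R) :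
    CoordCell w' R :=
  ⟨fun k => m.reeb (extendZero q.coord) k, by
    have h := q.mem
    rw [m.partialProd_reeb h2 _ m.not_inner_length] at h
    rwa [m.reeb_eq_extendZero, ← m.length_eq]⟩

/-- A braid move acts on the coordinates by a bijection, inverse to that of the inverse move. -/
def BraidMove.cellEquiv (h2 : (2 : R) = 0) (m : BraidMove w w') :
    CoordCell w R ≃ CoordCell w' R where
  toFun := m.cellMap h2
  invFun := m.symm.cellMap h2
  left_inv q := CoordCell.ext (funext fun k => by
    simp only [BraidMove.cellMap]
    rw [m.reeb_eq_extendZero, m.reeb_symm h2, extendZero_val])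
  right_inv q := CoordCell.ext (funext fun k => by
    have := m.symm.reeb_symm h2 (extendZero q.coord)
    have e : m.symm.symm = m := by cases m <;> rfl
    rw [e] at this
    simp only [BraidMove.cellMap]
    rw [m.symm.reeb_eq_extendZero, this, extendZero_val])

lemma BraidMove.reeb_map {S : Type u} [CommRing S] (f : R →+* S) (m : BraidMove w w') (q : ℕ → R)
    (k : ℕ) : f (m.reeb q k) = m.reeb (fun j => f (q j)) k := by
  cases m <;> simp only [BraidMove.reeb] <;> split_ifs <;> simp

lemma BraidMove.cellMap_map {S : Type u} [CommRing S] (f : R →+* S) (h2 : (2 : R) = 0)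
    (h2' : (2 : S) = 0) (m : BraidMove w w') (q : CoordCell w R) :
    m.cellMap h2' (q.map f) = (m.cellMap h2 q).map f :=
  CoordCell.ext (funext fun k => by
    simp only [BraidMove.cellMap, CoordCell.map]
    rw [m.reeb_map, comp_extendZero])

/-- The correspondence of two points of the double Bott–Samelson cells under a braid move, in affine
coordinates. -/
lemma BraidMove.flagRel_toConf_iff (h2 : (2 : R) = 0) (m : BraidMove w w') (q : CoordCell w R)
    (c' : Conf w' R) :
    (∃ (X : Collection w R) (X' : Collection w' R), Conf.mk X = q.toConf ∧ Conf.mk X' = c' ∧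
      X.top = X'.top ∧
      ∀ (k : ℕ) (h : k < w.length + 1) (h' : k < w'.length + 1), ¬ m.Inner k →
        X.flag ⟨k, h⟩ = X'.flag ⟨k, h'⟩) ↔ (m.cellMap h2 q).toConf = c' := by
  have hstd : ∀ k, ¬ m.Inner k → partialProd w (extendZero q.coord) k =
      partialProd w' (extendZero (m.cellMap h2 q).coord) k := fun k hk => by
    simp only [BraidMove.cellMap]
    rw [m.reeb_eq_extendZero, m.partialProd_reeb h2 _ hk]
  constructor
  · rintro ⟨X, X', hX, rfl, htop, hflag⟩
    obtain ⟨g, hg⟩ := Conf.mk_eq_mk.1 hX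
    rw [← Conf.mk_act g X']
    refine congrArg Conf.mk (Collection.eq_of_not_inner m ?_ fun k hk hin => ?_)
    · change DecFlag.mk 1 = X'.top.act g
      rw [← htop]
      exact congrArg Collection.top hg.symm
    · have hk0 : k < w.length + 1 := m.length_eq ▸ hk
      change ((partialProd w' _ k : Matrix.SpecialLinearGroup (Fin n) R) : SLFlag n R) =
        g • X'.flag ⟨k, hk⟩
      rw [← hflag k hk0 hk hin, ← hstd k hin]
      exact congrArg (fun Y : Collection w R => Y.flag ⟨k, hk0⟩) hg.symm
  · rintro rfl
    exact ⟨_, _, rfl, rfl, rfl, fun k _ _ hin =>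
      congrArg (fun x : Matrix.SpecialLinearGroup (Fin n) R => (x : SLFlag n R)) (hstd k hin)⟩

end CoordCell

/-! ### Sums over finite types that are built step by step -/

section SumsTo

variable {R : Type u} [CommRing R]

/-- The type `α` is finite, and the sum of `g` over it is `v`. -/
def SumsTo {α : Type} (g : α → R) (v : R) : Prop := ∃ _ : Fintype α, ∑ a, g a = v

lemma SumsTo.congr {α : Type} {g : α → R} {u v : R} (h : SumsTo g v) (e : u = v) : SumsTo g u :=
  e ▸ h

lemma SumsTo.of_bijective {α β : Type} {g : α → R} {v : R} {e : β → α} (he : Function.Bijective e)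
    (h : SumsTo (fun b => g (e b)) v) : SumsTo g v := by
  obtain ⟨_, h⟩ := h
  let _ : Fintype α := Fintype.ofEquiv β (Equiv.ofBijective e he)
  exact ⟨inferInstance, (he.sum_comp g).symm.trans h⟩

lemma SumsTo.sum {α β : Type} {g : α ⊕ β → R} {u v : R} (h1 : SumsTo (fun a => g (.inl a)) u)
    (h2 : SumsTo (fun b => g (.inr b)) v) : SumsTo g (u + v) := by
  obtain ⟨_, h1⟩ := h1
  obtain ⟨_, h2⟩ := h2
  exact ⟨inferInstance, by rw [Fintype.sum_sum_type, h1, h2]⟩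

lemma SumsTo.sigma {ι : Type} {p : ι → Prop} {β : ι → Type} {g : (Σ s : {s // p s}, β s.1) → R}
    {v : ι → R} (S : Finset ι) (hS : ∀ s, s ∈ S ↔ p s)
    (h : ∀ s : {s // p s}, SumsTo (fun b => g ⟨s, b⟩) (v s)) : SumsTo g (∑ s ∈ S, v s) := by
  choose _ h using h
  let _ : Fintype {s // p s} := Fintype.subtype S hS
  exact ⟨inferInstance, by
    rw [Fintype.sum_sigma, Finset.sum_subtype S hS]
    exact Finset.sum_congr rfl fun s _ => h s⟩

lemma SumsTo.prod {α β : Type} {g : α → R} {k : β → R} {u v : R} (h1 : SumsTo g u)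
    (h2 : SumsTo k v) (c : R) : SumsTo (fun x : α × β => g x.1 * c * k x.2) (u * c * v) := by
  obtain ⟨_, h1⟩ := h1
  obtain ⟨_, h2⟩ := h2
  exact ⟨inferInstance, by
    rw [Fintype.sum_prod_type, ← h1, ← h2, Finset.sum_mul, Finset.sum_mul_sum]⟩

lemma SumsTo.of_isEmpty {α : Type} (g : α → R) (h : IsEmpty α) : SumsTo g 0 :=
  ⟨Fintype.ofIsEmpty, by simp⟩

lemma SumsTo.eq_zero {α : Type} {g : α → R} {v : R} (h : SumsTo g v) (hα : IsEmpty α) : v = 0 := by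
  obtain ⟨_, rfl⟩ := h
  exact Finset.sum_of_isEmpty _

lemma SumsTo.of_unique {α : Type} {g : α → R} (a : α) (h : ∀ b, b = a) : SumsTo g (g a) := by
  let _ : Unique α := ⟨⟨a⟩, h⟩
  exact ⟨inferInstance, Fintype.sum_unique g⟩

lemma SumsTo.prop_prod {α : Type} {p : Prop} [Decidable p] {g : α → R} {v : R}
    (h : SumsTo g v) : SumsTo (fun x : PLift p × α => g x.2) (if p then v else 0) := by
  split_ifs with hp
  · exact SumsTo.of_bijective (e := fun a => (⟨hp⟩, a))
      ⟨fun _ _ h => congrArg Prod.snd h, fun ⟨⟨_⟩, a⟩ => ⟨a, rfl⟩⟩ h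
  · exact SumsTo.of_isEmpty _ ⟨fun x => hp x.1.down⟩

end SumsTo

/-! ### Sums over the pieces of immersed disks -/

section Pieces

variable {C T : Type} {D : Diagram C T}

lemma Piece.lt_of_left {s : Side} {x i j : ℕ} (P : Piece D s x i j) (hs : s = .left) : i < j := by
  cases P <;> omega

/-- If every right cap is preceded by a crossing of the two strands that it joins, then a piece to
the right of a cut is the inside of a right cap: the disk cannot be continued to the left through
the top or bottom quadrants of that crossing. -/
lemma Piece.exists_rightCap
    (hD : ∀ x p t, D[x + 1]? = some (.rightCap p t) → ∃ c, D[x]? = some (.crossing p c))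
    {s : Side} {x i j : ℕ} (P : Piece D s x i j) (hs : s = .right) :
    ∃ t, D[x]? = some (.rightCap i t) ∧ j = i + 1 := by
  induction P with
  | birth | stepLeft | merge | splitUpper | splitLower => cases hs
  | death h => exact ⟨_, h, rfl⟩
  | @stepRight x i j i' j' e o o' h hu hl hij hij' P ih =>
    obtain ⟨t, h', rfl⟩ := ih rfl
    obtain ⟨c, hc⟩ := hD _ _ _ h'
    obtain rfl : e = .crossing i' c := Option.some.inj (h.symm.trans hc)
    have hi : i = i' + 1 := by
      generalize hq : i' = q at hu hc
      cases hu with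
      | follow h => cases h <;> omega
    have hj : j = i' := by
      generalize hq : i' + 1 = q at hl
      cases hl with
      | follow h => cases h <;> first | rfl | omega
      | corner => omega
    omega
  | mergeUpper h _ _ _ _ _ ih | mergeLower h _ _ _ _ _ ih | split h _ _ _ _ _ ih =>
    obtain ⟨t, h', -⟩ := ih rfl
    obtain ⟨c, hc⟩ := hD _ _ _ h'
    cases h.symm.trans hc

/-- The possible last steps of a piece that continues through the event `e`: the strands before `e`
at the upper and at the lower end, with possible corners. -/
abbrev StepIndex (e : Event C T) (i' j' : ℕ) : Type :=
  {s : (ℕ × Option C) × (ℕ × Option C) // UpperEdge e s.1.1 i' s.1.2 ∧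
    LowerEdge e s.2.1 j' s.2.2 ∧ s.1.1 < s.2.1 ∧ i' < j'}

/-- The pieces to the left of a cut just after the event `e` that continue through `e`. -/
def contPiece {x : ℕ} {e : Event C T} (hx : D[x]? = some e) (i' j' : ℕ)
    (s : Σ s : StepIndex e i' j', Piece D .left x s.1.1.1 s.1.2.1) : Piece D .left (x + 1) i' j' :=
  .stepLeft hx s.1.2.1 s.1.2.2.1 s.1.2.2.2.1 s.1.2.2.2.2 s.2

lemma contPiece_injective {x : ℕ} {e : Event C T} (hx : D[x]? = some e) (i' j' : ℕ) :
    Function.Injective (contPiece hx i' j') := by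
  rintro ⟨⟨⟨⟨i, o⟩, ⟨j, o'⟩⟩, hs⟩, P⟩ ⟨⟨⟨⟨k, q⟩, ⟨m, q'⟩⟩, hs'⟩, P'⟩ h
  cases h
  rfl

variable {R : Type u} [CommRing R] (η : CEWord C T →* R)

lemma sumsTo_contPiece {x : ℕ} {e : Event C T} (hx : D[x]? = some e) {f : ℕ → ℕ → R}
    (hf : ∀ i j, SumsTo (fun P : Piece D .left x i j => η P.word) (f i j)) (i' j' : ℕ)
    (U L : Finset (ℕ × Option C)) (hU : ∀ s, s ∈ U ↔ UpperEdge e s.1 i' s.2)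
    (hL : ∀ s, s ∈ L ↔ LowerEdge e s.1 j' s.2) :
    SumsTo (fun s => η (contPiece hx i' j' s).word) (if i' < j' then
      ∑ a ∈ U, ∑ b ∈ L, η (cornerWord a.2) * η (cornerWord b.2) * f a.1 b.1 else 0) := by
  have hf0 : ∀ i j, ¬ i < j → f i j = 0 := fun i j hij =>
    (hf i j).eq_zero ⟨fun P => hij (P.lt_of_left rfl)⟩
  by_cases hij : i' < j'
  · have h := SumsTo.sigma (p := fun s => UpperEdge e s.1.1 i' s.1.2 ∧
        LowerEdge e s.2.1 j' s.2.2 ∧ s.1.1 < s.2.1 ∧ i' < j')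
      (β := fun s => Piece D .left x s.1.1 s.2.1) (g := fun s => η (contPiece hx i' j' s).word)
      (v := fun s => η (cornerWord s.1.2) * η (cornerWord s.2.2) * f s.1.1 s.2.1)
      ((U ×ˢ L).filter fun s => s.1.1 < s.2.1) (by simp [hU, hL, hij, and_assoc]) (fun s => by
        obtain ⟨_, h⟩ := hf s.1.1.1 s.1.2.1
        refine ⟨inferInstance, ?_⟩
        rw [← h, Finset.mul_sum]
        refine Finset.sum_congr rfl fun P _ => ?_
        simp only [contPiece, Piece.word, map_mul]
        ring)
    rw [if_pos hij]
    convert h using 1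
    rw [Finset.sum_filter_of_ne, Finset.sum_product]
    intro s _ hs
    by_contra hlt
    exact hs (by rw [hf0 _ _ hlt, mul_zero])
  · rw [if_neg hij]
    exact SumsTo.of_isEmpty _ ⟨fun s => hij s.1.2.2.2.2⟩

/-- The effect of a crossing of the strands `p` and `p + 1`, with chord `c`, on functions of the
upper boundary strand. -/
def upperCross (p : ℕ) (c : R) (g : ℕ → R) (i : ℕ) : R :=
  if i = p then g (p + 1) else if i = p + 1 then g p + c * g (p + 1) else g i

/-- The effect of a crossing of the strands `p` and `p + 1`, with chord `c`, on functions of the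
lower boundary strand. -/
def lowerCross (p : ℕ) (c : R) (g : ℕ → R) (j : ℕ) : R :=
  if j = p then g (p + 1) + c * g p else if j = p + 1 then g p else g j

lemma upperEdge_crossing_iff {p : ℕ} {c : C} {i i' : ℕ} {o : Option C} :
    UpperEdge (.crossing p c : Event C T) i i' o ↔
      (i' = p ∧ i = p + 1 ∧ o = none) ∨ (i' = p + 1 ∧ i = p ∧ o = none) ∨
      (i' = p + 1 ∧ i = p + 1 ∧ o = some c) ∨ (i' ≠ p ∧ i' ≠ p + 1 ∧ i = i' ∧ o = none) := by
  constructor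
  · intro h
    cases h with
    | follow h => cases h <;> simp_all
    | corner => simp
  · rintro (⟨rfl, rfl, rfl⟩ | ⟨rfl, rfl, rfl⟩ | ⟨rfl, rfl, rfl⟩ | ⟨h1, h2, rfl, rfl⟩)
    · exact .follow (.up _ _)
    · exact .follow (.down _ _)
    · exact .corner _ _
    · exact .follow (.away _ _ _ h1 h2)

lemma lowerEdge_crossing_iff {p : ℕ} {c : C} {j j' : ℕ} {o : Option C} :
    LowerEdge (.crossing p c : Event C T) j j' o ↔
      (j' = p ∧ j = p + 1 ∧ o = none) ∨ (j' = p ∧ j = p ∧ o = some c) ∨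
      (j' = p + 1 ∧ j = p ∧ o = none) ∨ (j' ≠ p ∧ j' ≠ p + 1 ∧ j = j' ∧ o = none) := by
  constructor
  · intro h
    cases h with
    | follow h => cases h <;> simp_all
    | corner => simp
  · rintro (⟨rfl, rfl, rfl⟩ | ⟨rfl, rfl, rfl⟩ | ⟨rfl, rfl, rfl⟩ | ⟨h1, h2, rfl, rfl⟩)
    · exact .follow (.up _ _)
    · exact .corner _ _
    · exact .follow (.down _ _)
    · exact .follow (.away _ _ _ h1 h2)

open scoped Classical in
lemma exists_upperEdge_crossing (p : ℕ) (c : C) (i' : ℕ) : ∃ U : Finset (ℕ × Option C),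
    (∀ s, s ∈ U ↔ UpperEdge (.crossing p c : Event C T) s.1 i' s.2) ∧
    ∀ g : ℕ → R, ∑ a ∈ U, η (cornerWord a.2) * g a.1 = upperCross p (η (chordWord c)) g i' := by
  unfold upperCross
  split_ifs with h1 h2
  · exact ⟨{(p + 1, none)}, fun s => by simp [upperEdge_crossing_iff, h1, Prod.ext_iff],
      fun g => by simp [cornerWord]⟩
  · refine ⟨{(p, none), (p + 1, some c)}, fun s => by
      simp [upperEdge_crossing_iff, h2, Prod.ext_iff], fun g => ?_⟩
    rw [Finset.sum_pair (by simp)]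
    simp [cornerWord]
  · exact ⟨{(i', none)}, fun s => by simp [upperEdge_crossing_iff, h1, h2, Prod.ext_iff],
      fun g => by simp [cornerWord]⟩

open scoped Classical in
lemma exists_lowerEdge_crossing (p : ℕ) (c : C) (j' : ℕ) : ∃ L : Finset (ℕ × Option C),
    (∀ s, s ∈ L ↔ LowerEdge (.crossing p c : Event C T) s.1 j' s.2) ∧
    ∀ g : ℕ → R, ∑ a ∈ L, η (cornerWord a.2) * g a.1 = lowerCross p (η (chordWord c)) g j' := by
  unfold lowerCross
  split_ifs with h1 h2
  · refine ⟨{(p + 1, none), (p, some c)}, fun s => by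
      simp [lowerEdge_crossing_iff, h1, Prod.ext_iff], fun g => ?_⟩
    rw [Finset.sum_pair (by simp)]
    simp [cornerWord]
  · exact ⟨{(p, none)}, fun s => by simp [lowerEdge_crossing_iff, h2, Prod.ext_iff],
      fun g => by simp [cornerWord]⟩
  · exact ⟨{(j', none)}, fun s => by simp [lowerEdge_crossing_iff, h1, h2, Prod.ext_iff],
      fun g => by simp [cornerWord]⟩

variable {η}

/-- The words of the pieces just after a crossing, in terms of those just before it. -/
lemma sumsTo_crossing {x p : ℕ} {c : C} (hx : D[x]? = some (.crossing p c)) {f : ℕ → ℕ → R}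
    (hf : ∀ i j, SumsTo (fun P : Piece D .left x i j => η P.word) (f i j)) (i' j' : ℕ) :
    SumsTo (fun P : Piece D .left (x + 1) i' j' => η P.word) (if i' < j' then
      upperCross p (η (chordWord c)) (fun i => lowerCross p (η (chordWord c)) (f i) j') i'
      else 0) := by
  obtain ⟨U, hU, hU'⟩ := exists_upperEdge_crossing (T := T) η p c i'
  obtain ⟨L, hL, hL'⟩ := exists_lowerEdge_crossing (T := T) η p c j'
  have h := sumsTo_contPiece η hx hf i' j' U L hU hL
  rw [← hU']
  simp only [← hL']
  simp only [mul_assoc, ← Finset.mul_sum] at h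
  refine SumsTo.of_bijective ⟨contPiece_injective hx i' j', fun P => ?_⟩ h
  cases P with
  | birth hy | merge hy | splitUpper hy | splitLower hy => cases hy.symm.trans hx
  | @stepLeft _ i j _ _ e o o' h hu hl hij hij' P =>
    obtain rfl := Option.some.inj (h.symm.trans hx)
    exact ⟨⟨⟨((i, o), (j, o')), hu, hl, hij, hij'⟩, P⟩, rfl⟩

/-- The words of the pieces just after a right cap, in terms of those just before it. -/
lemma sumsTo_rightCap {x p : ℕ} {t : T} (hx : D[x]? = some (.rightCap p t)) {f : ℕ → ℕ → R}
    (hf : ∀ i j, SumsTo (fun P : Piece D .left x i j => η P.word) (f i j)) (i j : ℕ) :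
    SumsTo (fun P : Piece D .left (x + 1) i j => η P.word)
      ((if i < j then f (skipPair p i) (skipPair p j) else 0) +
        if i < p ∧ p ≤ j then f i p * η (markWord t) * f (p + 1) (j + 2) else 0) := by
  have hedge : ∀ i' i (o : Option C), UpperEdge (.rightCap p t : Event C T) i' i o ↔
      i' = skipPair p i ∧ o = none := by
    intro i' i o
    constructor
    · intro h
      cases h with
      | follow h => cases h; exact ⟨rfl, rfl⟩
    · rintro ⟨rfl, rfl⟩
      exact .follow (.rightCap _ _ _)
  have hedge' : ∀ i' i (o : Option C), LowerEdge (.rightCap p t : Event C T) i' i o ↔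
      i' = skipPair p i ∧ o = none := by
    intro i' i o
    constructor
    · intro h
      cases h with
      | follow h => cases h; exact ⟨rfl, rfl⟩
    · rintro ⟨rfl, rfl⟩
      exact .follow (.rightCap _ _ _)
  have h1 := sumsTo_contPiece η hx hf i j {(skipPair p i, none)} {(skipPair p j, none)}
    (fun s => by simp [hedge, Prod.ext_iff]) (fun s => by simp [hedge', Prod.ext_iff])
  simp only [Finset.sum_singleton, cornerWord, map_one, one_mul] at h1
  have h2 := SumsTo.prop_prod (p := i < p ∧ p ≤ j)
    ((hf i p).prod (hf (p + 1) (j + 2)) (η (markWord t)))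
  refine SumsTo.of_bijective (e := Sum.elim (contPiece hx i j) fun y : PLift (i < p ∧ p ≤ j) ×
      Piece D .left x i p × Piece D .left x (p + 1) (j + 2) =>
    .merge hx y.1.down.1 y.1.down.2 y.2.1 y.2.2) ⟨?_, fun P => ?_⟩ (SumsTo.sum h1 ?_)
  · refine (contPiece_injective hx i j).sumElim ?_ fun s y h => by cases h
    rintro ⟨⟨_⟩, P, Q⟩ ⟨⟨_⟩, P', Q'⟩ h
    cases h
    rfl
  · cases P with
    | birth h | splitUpper h | splitLower h => cases h.symm.trans hx
    | @stepLeft _ i j _ _ e o o' h hu hl hij hij' P =>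
      obtain rfl := Option.some.inj (h.symm.trans hx)
      exact ⟨.inl ⟨⟨((i, o), (j, o')), hu, hl, hij, hij'⟩, P⟩, rfl⟩
    | merge h hi hj P Q =>
      obtain ⟨rfl, rfl⟩ := Event.rightCap.inj (Option.some.inj (h.symm.trans hx))
      exact ⟨.inr ⟨⟨hi, hj⟩, P, Q⟩, rfl⟩
  · convert h2 using 2
    simp only [Sum.elim_inr, Piece.word, map_mul]

/-- The words of the pieces just after a left cap, in terms of those just before it, provided that
there are no pieces to the right of the cap. -/
lemma sumsTo_leftCap {x p : ℕ} (hx : D[x]? = some (.leftCap p))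
    (hr : ∀ i j, IsEmpty (Piece D .right (x + 1) i j)) {f : ℕ → ℕ → R}
    (hf : ∀ i j, SumsTo (fun P : Piece D .left x i j => η P.word) (f i j)) (i' j' : ℕ) :
    SumsTo (fun P : Piece D .left (x + 1) i' j' => η P.word)
      ((if i' < j' ∧ (i' < p ∨ p + 2 ≤ i') ∧ (j' < p ∨ p + 2 ≤ j') then
          f (if i' < p then i' else i' - 2) (if j' < p then j' else j' - 2) else 0) +
        if i' = p ∧ j' = p + 1 then 1 else 0) := by
  have hstep : ∀ i' i, StrandStep (.leftCap p : Event C T) i i' ↔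
      (i' < p ∨ p + 2 ≤ i') ∧ i = if i' < p then i' else i' - 2 := by
    intro i' i
    constructor
    · intro h
      cases h
      unfold skipPair
      split_ifs <;> omega
    · rintro ⟨h, rfl⟩
      have : i' = skipPair p (if i' < p then i' else i' - 2) := by
        unfold skipPair
        split_ifs <;> omega
      generalize (if i' < p then i' else i' - 2) = y at this
      rw [this]
      exact .leftCap _ _
  have hedge : ∀ i' i (o : Option C), UpperEdge (.leftCap p : Event C T) i i' o ↔
      ((i' < p ∨ p + 2 ≤ i') ∧ i = if i' < p then i' else i' - 2) ∧ o = none := by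
    intro i' i o
    rw [← hstep]
    constructor
    · intro h
      cases h with
      | follow h => exact ⟨h, rfl⟩
    · rintro ⟨h, rfl⟩
      exact .follow h
  have hedge' : ∀ i' i (o : Option C), LowerEdge (.leftCap p : Event C T) i i' o ↔
      ((i' < p ∨ p + 2 ≤ i') ∧ i = if i' < p then i' else i' - 2) ∧ o = none := by
    intro i' i o
    rw [← hstep]
    constructor
    · intro h
      cases h with
      | follow h => exact ⟨h, rfl⟩
    · rintro ⟨h, rfl⟩
      exact .follow h
  have h1 := sumsTo_contPiece η hx hf i' j'
    (if i' < p ∨ p + 2 ≤ i' then {(if i' < p then i' else i' - 2, none)} else ∅)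
    (if j' < p ∨ p + 2 ≤ j' then {(if j' < p then j' else j' - 2, none)} else ∅)
    (fun s => by rw [hedge]; split_ifs <;> simp_all [Prod.ext_iff])
    (fun s => by rw [hedge']; split_ifs <;> simp_all [Prod.ext_iff])
  have h2 : SumsTo (fun _ : PLift (i' = p ∧ j' = p + 1) × Unit => (1 : R))
      (if i' = p ∧ j' = p + 1 then 1 else 0) :=
    SumsTo.prop_prod (g := fun _ : Unit => (1 : R)) (SumsTo.of_unique () fun _ => rfl)
  have e : (if i' < j' then ∑ a ∈ (if i' < p ∨ p + 2 ≤ i' then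
        {(if i' < p then i' else i' - 2, (none : Option C))} else ∅),
      ∑ b ∈ (if j' < p ∨ p + 2 ≤ j' then {(if j' < p then j' else j' - 2, (none : Option C))}
        else ∅), η (cornerWord a.2) * η (cornerWord b.2) * f a.1 b.1 else 0) =
      if i' < j' ∧ (i' < p ∨ p + 2 ≤ i') ∧ (j' < p ∨ p + 2 ≤ j') then
          f (if i' < p then i' else i' - 2) (if j' < p then j' else j' - 2) else 0 := by
    by_cases c1 : i' < j' <;> by_cases c2 : i' < p ∨ p + 2 ≤ i' <;>
      by_cases c3 : j' < p ∨ p + 2 ≤ j' <;> simp [c1, c2, c3, cornerWord]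
  rw [e] at h1
  refine SumsTo.of_bijective (e := Sum.elim (contPiece hx i' j') fun y :
      PLift (i' = p ∧ j' = p + 1) × Unit => y.1.down.1 ▸ y.1.down.2 ▸ .birth hx) ⟨?_, fun P => ?_⟩ (SumsTo.sum h1 ?_)
  · refine (contPiece_injective hx i' j').sumElim ?_ fun s y h => ?_
    · rintro ⟨⟨_⟩, _⟩ ⟨⟨_⟩, _⟩ _
      rfl
    · obtain ⟨⟨rfl, rfl⟩, _⟩ := y
      cases h
  · cases P with
    | merge h => cases h.symm.trans hx
    | splitUpper h hi hj P Q | splitLower h hi hj P Q => exact ((hr _ _).false Q).elim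
    | birth h =>
      obtain rfl := Event.leftCap.inj (Option.some.inj (h.symm.trans hx))
      exact ⟨.inr ⟨⟨rfl, rfl⟩, ()⟩, rfl⟩
    | @stepLeft _ i j _ _ e o o' h hu hl hij hij' P =>
      obtain rfl := Option.some.inj (h.symm.trans hx)
      exact ⟨.inl ⟨⟨((i, o), (j, o')), hu, hl, hij, hij'⟩, P⟩, rfl⟩
  · convert h2 using 2 with y
    obtain ⟨⟨rfl, rfl⟩, _⟩ := y
    simp [Piece.word]

end Pieces

/-! ### The differential of the Reeb chords of a rainbow closure -/

section LinkDiagram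

variable {n : ℕ} (w : BraidWord n)

lemma getElem?_flatMap_pair {α β : Type*} (f g : α → β) (L : List α) (k : ℕ) :
    (L.flatMap fun a => [f a, g a])[2 * k]? = L[k]?.map f ∧
    (L.flatMap fun a => [f a, g a])[2 * k + 1]? = L[k]?.map g := by
  induction L generalizing k with
  | nil => simp
  | cons a L ih =>
    cases k with
    | zero => simp
    | succ k => simpa [Nat.mul_succ] using ih k

lemma linkDiagram_leftCap {x : ℕ} (hx : x < n) :
    (linkDiagram w)[x]? = some (.leftCap x) := by
  simp [linkDiagram, hx, Nat.lt_add_right]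

lemma linkDiagram_braid (k : Fin w.length) :
    (linkDiagram w)[n + k]? = some (.crossing (n + w.get k) (.braid k)) := by
  simp [linkDiagram, List.getElem?_append]

lemma linkDiagram_cusp (k : Fin n) :
    (linkDiagram w)[n + w.length + 2 * k]? = some (.crossing (n - 1 - k) (.cusp k)) ∧
    (linkDiagram w)[n + w.length + 2 * k + 1]? = some (.rightCap (n - 1 - k) k) := by
  have h := getElem?_flatMap_pair
    (fun k : Fin n => (Event.crossing (n - 1 - (k : ℕ)) (LinkChord.cusp k) :
      Event (LinkChord w.length n) (Fin n)))
    (fun k : Fin n => Event.rightCap (n - 1 - (k : ℕ)) k) (List.finRange n) k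
  have hk : (List.finRange n)[(k : ℕ)]? = some k := by simp
  rw [hk] at h
  unfold linkDiagram
  constructor
  · rw [List.getElem?_append_right (by simp)]
    simpa using h.1
  · rw [List.getElem?_append_right (by simp; omega)]
    refine Eq.trans (congrArg _ ?_) h.2
    simp
    omega

lemma linkDiagram_length : (linkDiagram w).length = n + w.length + 2 * n := by
  simp [linkDiagram, List.length_flatMap, mul_comm, add_assoc]

/-- The events of the diagram of a rainbow closure. -/
lemma linkDiagram_cases {x : ℕ} {e : Event (LinkChord w.length n) (Fin n)}
    (h : (linkDiagram w)[x]? = some e) :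
    (x < n ∧ e = .leftCap x) ∨
    (∃ k : Fin w.length, x = n + k ∧ e = .crossing (n + w.get k) (.braid k)) ∨
    (∃ k : Fin n, x = n + w.length + 2 * k ∧ e = .crossing (n - 1 - k) (.cusp k)) ∨
    (∃ k : Fin n, x = n + w.length + 2 * k + 1 ∧ e = .rightCap (n - 1 - k) k) := by
  have hx : x < n + w.length + 2 * n := by
    rw [← linkDiagram_length w]
    exact (List.getElem?_eq_some_iff.1 h).1
  by_cases h1 : x < n
  · exact Or.inl ⟨h1, Option.some.inj (h.symm.trans (linkDiagram_leftCap w h1))⟩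
  by_cases h2 : x < n + w.length
  · obtain ⟨k, rfl⟩ := Nat.exists_eq_add_of_le (not_lt.1 h1)
    have e := linkDiagram_braid w ⟨k, by omega⟩
    exact Or.inr (Or.inl ⟨⟨k, by omega⟩, rfl, Option.some.inj (h.symm.trans e)⟩)
  obtain ⟨y, rfl⟩ := Nat.exists_eq_add_of_le (not_lt.1 h2)
  have e := linkDiagram_cusp w ⟨y / 2, by omega⟩
  rcases Nat.mod_two_eq_zero_or_one y with hy | hy
  · have e1 : y = 2 * (y / 2) := by omega
    refine Or.inr (Or.inr (Or.inl ⟨⟨y / 2, by omega⟩, by simp only; omega, ?_⟩))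
    refine Option.some.inj (h.symm.trans (Eq.trans ?_ e.1))
    simp only
    rw [← e1]
  · have e1 : y = 2 * (y / 2) + 1 := by omega
    refine Or.inr (Or.inr (Or.inr ⟨⟨y / 2, by omega⟩, by simp only; omega, ?_⟩))
    refine Option.some.inj (h.symm.trans (Eq.trans ?_ e.2))
    simp only
    rw [add_assoc _ (2 * _) 1, ← e1]

lemma linkDiagram_before_rightCap (x p : ℕ) (t : Fin n)
    (h : (linkDiagram w)[x + 1]? = some (.rightCap p t)) :
    ∃ c, (linkDiagram w)[x]? = some (.crossing p c) := by
  rcases linkDiagram_cases w h with ⟨-, e⟩ | ⟨k, -, e⟩ | ⟨k, -, e⟩ | ⟨k, hx, e⟩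
  · cases e
  · cases e
  · cases e
  · obtain ⟨rfl, rfl⟩ := Event.rightCap.inj e
    obtain rfl : x = n + w.length + 2 * (t : ℕ) := by omega
    exact ⟨_, (linkDiagram_cusp w t).1⟩

variable {R : Type u} [CommRing R] (η : CEWord (LinkChord w.length n) (Fin n) →* R)

/-- The pieces in the region of the left cusps: each left cap bounds exactly one. -/
lemma sumsTo_caps {x : ℕ} (hx : x ≤ n) (i j : ℕ) :
    SumsTo (fun P : Piece (linkDiagram w) .left x i j => η P.word)
      (if i < x ∧ i + j + 1 = 2 * x then 1 else 0) := by
  induction x generalizing i j with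
  | zero =>
    have h := SumsTo.of_isEmpty (fun P : Piece (linkDiagram w) .left 0 i j => η P.word)
      ⟨fun P => by generalize hy : 0 = y at P; cases P <;> omega⟩
    simpa using h
  | succ x ih =>
    have hr : ∀ i j, IsEmpty (Piece (linkDiagram w) .right (x + 1) i j) := fun i j => ⟨fun P => by
      obtain ⟨t, h, -⟩ := P.exists_rightCap (linkDiagram_before_rightCap w) rfl
      obtain ⟨c, h⟩ := linkDiagram_before_rightCap w _ _ _ h
      rw [linkDiagram_leftCap w hx] at h
      cases h⟩
    have h := sumsTo_leftCap (linkDiagram_leftCap w hx) hr (ih (by omega)) i j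
    refine h.congr ?_
    split_ifs <;> first | omega | simp

/-- In characteristic two, right multiplication by `R_i(q)` acts on the columns in the same way as a
crossing with chord `q` acts on the lower boundary strands of the pieces. -/
lemma entry_mul_wordFactor (h2 : (2 : R) = 0) (g : Matrix.SpecialLinearGroup (Fin n) R)
    (b : ℕ → R) {k : ℕ} (hk : k < w.length) (r c : ℕ) :
    entry (g * wordFactor w b k) r c = lowerCross (w[k] : ℕ) (b k) (entry g r) c := by
  have hn : ∀ x : R, -x = x := fun x => by linear_combination -x * h2
  rw [wordFactor_of_lt b hk]
  have ha := (w[k]).2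
  unfold lowerCross entry
  by_cases hr : r < n
  · by_cases hc : c < n
    · simp only [hr, hc, mul_rMat_apply, rowLo, rowHi, Fin.ext_iff, hn, true_and, dif_pos,
        show (w[k] : ℕ) < n by omega, show (w[k] : ℕ) + 1 < n by omega]
      split_ifs <;> subst_vars <;> ring
    · simp [hc, show c ≠ (w[k] : ℕ) by omega, show c ≠ (w[k] : ℕ) + 1 by omega]
  · simp [hr]

lemma upperCross_eq_zero {p i : ℕ} {c : R} {g : ℕ → R} (hg : ∀ y, n ≤ y → g y = 0) (hp : n ≤ p)
    (hi : n ≤ i) : upperCross p c g i = 0 := by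
  unfold upperCross
  simp [hg i hi, hg p hp, hg (p + 1) (by omega)]

/-- The words of the pieces to the left of a cut in the braid: such a piece is bounded by an upper
strand, which determines a row, and by a strand of the braid, which determines a column of the
product of the matrices `R_{i_k}(b_k)`. -/
lemma sumsTo_braid (h2 : (2 : R) = 0) {m : ℕ} (hm : m ≤ w.length) (i j : ℕ) :
    SumsTo (fun P : Piece (linkDiagram w) .left (n + m) i j => η P.word)
      (if i < n ∧ n ≤ j then
        entry (partialProd w (extendZero fun k => η (chordWord (.braid k))) m) (n - 1 - i) (j - n)
      else 0) := by
  induction m generalizing i j with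
  | zero =>
    refine (sumsTo_caps w η le_rfl i j).congr ?_
    by_cases h : i < n ∧ n ≤ j
    · simp only [h, true_and, partialProd, entry, specialLinearGroup_one_apply, Fin.mk.injEq,
        if_true]
      split_ifs <;> first | rfl | omega
    · rw [if_neg h, if_neg (by omega)]
  | succ m ih =>
    have h := sumsTo_crossing (linkDiagram_braid w ⟨m, hm⟩) (ih (by omega)) i j
    refine h.congr ?_
    by_cases hij : i < n ∧ n ≤ j
    · rw [if_pos hij, if_pos (by omega), partialProd, entry_mul_wordFactor w h2 _ _ hm]
      unfold upperCross
      rw [if_neg (by omega), if_neg (by omega)]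
      have e : extendZero (fun k => η (chordWord (.braid k))) m =
          η (chordWord (.braid ⟨m, hm⟩)) := by simp [extendZero, show m < w.length from hm]
      rw [e]
      obtain ⟨c, rfl⟩ := Nat.exists_eq_add_of_le hij.2
      simp [lowerCross, hij.1, add_assoc]
    · rw [if_neg hij]
      symm
      split_ifs with hlt
      · by_cases hi : i < n
        · unfold upperCross lowerCross
          simp only [show i ≠ n + (w.get ⟨m, hm⟩ : ℕ) by omega,
            show i ≠ n + (w.get ⟨m, hm⟩ : ℕ) + 1 by omega,
            show j ≠ n + (w.get ⟨m, hm⟩ : ℕ) by omega,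
            show j ≠ n + (w.get ⟨m, hm⟩ : ℕ) + 1 by omega, if_false, if_neg hij]
        · refine upperCross_eq_zero (n := n) (fun y hy => ?_) (by omega) (by omega)
          simp [lowerCross, not_lt.2 hy]
      · rfl

/-- The effect of a crossing of the strands `p` and `p + 1`, with chord `0`, and a right cap that
joins these strands, on a function that is supported on the pairs of strands on different sides of
the level between `p` and `p + 1`. -/
lemma crossing_rightCap {F M : ℕ → ℕ → R} {p : ℕ} (t : R)
    (hM : ∀ i j, M i j =
      if i < j then upperCross p 0 (fun i => lowerCross p 0 (F i) j) i else 0)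
    (hF : ∀ i j, ¬ (i ≤ p ∧ p + 1 ≤ j) → F i j = 0) (i j : ℕ) :
    ((if i < j then M (skipPair p i) (skipPair p j) else 0) +
      if i < p ∧ p ≤ j then M i p * t * M (p + 1) (j + 2) else 0) =
    if i < p ∧ p ≤ j then F i (j + 2) + F i (p + 1) * t * F p (j + 2) else 0 := by
  have haway : ∀ i j, i ≠ p → i ≠ p + 1 → j ≠ p → j ≠ p + 1 → i < j → M i j = F i j := by
    intro i j h1 h2 h3 h4 h5
    rw [hM, if_pos h5]
    simp only [upperCross, lowerCross, h1, h2, h3, h4, if_false]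
  by_cases h : i < p ∧ p ≤ j
  · have e1 : skipPair p i = i := if_pos h.1
    have e2 : skipPair p j = j + 2 := if_neg (by omega)
    have e3 : M i p = F i (p + 1) := by
      rw [hM, if_pos h.1]
      simp only [upperCross, lowerCross, h.1.ne, show i ≠ p + 1 by omega, if_false, if_true,
        zero_mul, add_zero]
    have e4 : M (p + 1) (j + 2) = F p (j + 2) := by
      rw [hM, if_pos (by omega)]
      simp only [upperCross, lowerCross, show p + 1 ≠ p by omega, show j + 2 ≠ p by omega,
        show j + 2 ≠ p + 1 by omega, if_false, if_true, zero_mul, add_zero]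
    rw [if_pos (show i < j by omega), if_pos h, if_pos h, e1, e2, e3, e4,
      haway _ _ (by omega) (by omega) (by omega) (by omega) (by omega)]
  · rw [if_neg h, if_neg h, add_zero]
    split_ifs with hij
    · have hs : ∀ x, skipPair p x ≠ p ∧ skipPair p x ≠ p + 1 ∧ (skipPair p x ≤ p ↔ x < p) := by
        intro x
        unfold skipPair
        split_ifs <;> omega
      have hlt : skipPair p i < skipPair p j := by
        unfold skipPair
        split_ifs <;> omega
      have h1 := hs i
      have h2 := hs j
      rw [haway _ _ h1.1 h1.2.1 h2.1 h2.2.1 hlt]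
      exact hF _ _ (by omega)
    · rfl

/-- The words of the pieces to the left of a cut between the right cusps, if the Reeb chords at the
cusps are sent to zero: merging two pieces around a right cap is a step of Gaussian elimination. -/
lemma sumsTo_cusps (h2 : (2 : R) = 0) (h0 : ∀ k, η (chordWord (.cusp k)) = 0) {k : ℕ} (hk : k ≤ n)
    (i j : ℕ) :
    SumsTo (fun P : Piece (linkDiagram w) .left (n + w.length + 2 * k) i j => η P.word)
      (if i + k < n ∧ n ≤ j + k then
        schur (entry (partialProd w (extendZero fun k => η (chordWord (.braid k))) w.length))
          (extendZero fun k => η (markWord k)) k (n - 1 - i) (j + 2 * k - n)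
      else 0) := by
  induction k generalizing i j with
  | zero => simpa [schur] using sumsTo_braid w η h2 le_rfl i j
  | succ k ih =>
    set A := entry (partialProd w (extendZero fun k => η (chordWord (.braid k))) w.length)
    set t : ℕ → R := extendZero fun k => η (markWord k) with ht
    obtain ⟨p, hp⟩ : ∃ p, n = k + 1 + p := Nat.exists_eq_add_of_le hk
    have h1 := linkDiagram_cusp w ⟨k, hk⟩
    have ep : n - 1 - k = p := by omega
    simp only [ep] at h1
    have h := sumsTo_rightCap h1.2 (sumsTo_crossing h1.1 (ih (by omega))) i j
    rw [h0] at h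
    have et : η (markWord ⟨k, hk⟩) = t k := by simp [ht, extendZero, show k < n from hk]
    rw [et] at h
    refine h.congr ?_
    rw [crossing_rightCap (t k) (fun _ _ => rfl) fun i j hij => if_neg (by omega)]
    by_cases hij : i < p ∧ p ≤ j
    · rw [if_pos hij, if_pos (by omega), if_pos (by omega), if_pos (by omega), if_pos (by omega),
        show n - 1 - p = k by omega, show p + 1 + 2 * k - n = k by omega,
        show j + 2 * (k + 1) - n = j + 2 + 2 * k - n by omega, schur]
    · rw [if_neg hij, if_neg (by omega)]

/-- There is exactly one piece inside a right cap. -/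
lemma sumsTo_insideCap (k : Fin n) :
    SumsTo (fun P : Piece (linkDiagram w) .right (n + w.length + 2 * k + 1) (n - 1 - k)
      (n - 1 - k + 1) => η P.word) (η (Monoid.Coprod.inr (FreeGroup.of k)⁻¹)) := by
  have hcap := (linkDiagram_cusp w k).2
  refine SumsTo.of_unique (g := fun P : Piece (linkDiagram w) .right (n + w.length + 2 * k + 1)
    (n - 1 - k) (n - 1 - k + 1) => η P.word) (.death hcap) fun P => ?_
  have hno : ∀ {i j : ℕ}, Piece (linkDiagram w) .right (n + w.length + 2 * k + 1 + 1) i j → False :=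
    fun Q => by
      obtain ⟨t, h, -⟩ := Q.exists_rightCap (linkDiagram_before_rightCap w) rfl
      obtain ⟨c, h⟩ := linkDiagram_before_rightCap w _ _ _ h
      cases hcap.symm.trans h
  suffices H : ∀ q (hq : q = n - 1 - (k : ℕ) + 1) (Q : Piece (linkDiagram w) .right
      (n + w.length + 2 * k + 1) (n - 1 - k) q), Q = hq ▸ .death hcap from H _ rfl P
  clear P
  generalize n - 1 - (k : ℕ) = p at *
  intro q hq P
  cases P with
  | death h =>
    obtain ⟨-, rfl⟩ := Event.rightCap.inj (Option.some.inj (h.symm.trans hcap))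
    rfl
  | stepRight _ _ _ _ _ Q | mergeUpper _ _ _ _ Q | mergeLower _ _ _ _ Q | split _ _ _ _ Q =>
    exact (hno Q).elim

lemma map_chordDiff {C T : Type} {D : Diagram C T} {c : C} (ε : CEAlg C T →+* R) {v : R}
    (h : SumsTo (fun u : Disk D c => ε (MonoidAlgebra.of (ZMod 2) _ u.word)) v) :
    ε (chordDiff D c) = v := by
  obtain ⟨_, h⟩ := h
  rw [chordDiff, finsum_eq_sum_of_fintype, map_sum, h]

/-- Every chord of the braid is a cycle: the pieces next to a crossing of the braid that lie on its
left are bounded by an upper strand, and there are none on its right. -/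
lemma map_chordDiff_braid (ε : CEAlg (LinkChord w.length n) (Fin n) →+* R) (h2 : (2 : R) = 0)
    (k : Fin w.length) : ε (chordDiff (linkDiagram w) (.braid k)) = 0 := by
  let η : CEWord (LinkChord w.length n) (Fin n) →* R :=
    (ε : CEAlg (LinkChord w.length n) (Fin n) →* R).comp (MonoidAlgebra.of (ZMod 2) _)
  have h1 := linkDiagram_braid w k
  have hl := sumsTo_braid w η h2 k.2.le (n + w.get k) (n + w.get k + 1)
  rw [if_neg (by omega)] at hl
  refine map_chordDiff ε (SumsTo.of_bijective (e := Disk.leftQuadrant h1)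
    ⟨fun _ _ h => by cases h; rfl, fun u => ?_⟩ hl)
  have hpos : ∀ {x p : ℕ}, (linkDiagram w)[x]? = some (.crossing p (.braid k)) →
      x = n + k ∧ p = n + w.get k := by
    intro x p h
    rcases linkDiagram_cases w h with ⟨-, e⟩ | ⟨k, hx, e⟩ | ⟨k, -, e⟩ | ⟨k, -, e⟩
    · cases e
    · cases e; exact ⟨hx, rfl⟩
    · cases e
    · cases e
  cases u with
  | leftQuadrant h P =>
    obtain ⟨rfl, rfl⟩ := hpos h
    exact ⟨P, rfl⟩
  | rightQuadrant h P =>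
    obtain ⟨rfl, rfl⟩ := hpos h
    obtain ⟨t, h', -⟩ := P.exists_rightCap (linkDiagram_before_rightCap w) rfl
    rcases linkDiagram_cases w h' with ⟨-, e⟩ | ⟨_, -, e⟩ | ⟨_, -, e⟩ | ⟨k', hx, -⟩
    · cases e
    · cases e
    · cases e
    · omega

/-- The disks with a positive corner at a right cusp. -/
lemma map_chordDiff_cusp (ε : CEAlg (LinkChord w.length n) (Fin n) →+* R) (h2 : (2 : R) = 0)
    (h0 : ∀ k, ε (MonoidAlgebra.of (ZMod 2) _ (chordWord (.cusp k))) = 0) (k : Fin n) :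
    ε (chordDiff (linkDiagram w) (.cusp k)) =
      schur (entry (partialProd w
        (extendZero fun k => ε (MonoidAlgebra.of (ZMod 2) _ (chordWord (.braid k)))) w.length))
        (extendZero fun k => ε (MonoidAlgebra.of (ZMod 2) _ (markWord k))) k k k +
      ε (MonoidAlgebra.of (ZMod 2) _ (Monoid.Coprod.inr (FreeGroup.of k)⁻¹)) := by
  let η : CEWord (LinkChord w.length n) (Fin n) →* R :=
    (ε : CEAlg (LinkChord w.length n) (Fin n) →* R).comp (MonoidAlgebra.of (ZMod 2) _)
  have h1 := linkDiagram_cusp w k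
  have hl := sumsTo_cusps w η h2 h0 k.2.le (n - 1 - k) (n - 1 - k + 1)
  rw [if_pos (by omega), show n - 1 - (n - 1 - (k : ℕ)) = k by omega,
    show n - 1 - (k : ℕ) + 1 + 2 * k - n = k by omega] at hl
  refine map_chordDiff ε (SumsTo.of_bijective
    (e := Sum.elim (Disk.leftQuadrant h1.1) (Disk.rightQuadrant h1.1)) ⟨?_, fun u => ?_⟩
    (SumsTo.sum hl (sumsTo_insideCap w η k)))
  · exact Function.Injective.sumElim (fun _ _ h => by cases h; rfl) (fun _ _ h => by cases h; rfl)
      fun _ _ h => by cases h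
  · have hpos : ∀ {x p : ℕ}, (linkDiagram w)[x]? = some (.crossing p (.cusp k)) →
        x = n + w.length + 2 * k ∧ p = n - 1 - k := by
      intro x p h
      rcases linkDiagram_cases w h with ⟨-, e⟩ | ⟨k, -, e⟩ | ⟨k, hx, e⟩ | ⟨k, hx, e⟩
      · cases e
      · cases e
      · cases e; exact ⟨hx, rfl⟩
      · cases e
    cases u with
    | leftQuadrant h P =>
      obtain ⟨rfl, rfl⟩ := hpos h
      exact ⟨.inl P, rfl⟩
    | rightQuadrant h P =>
      obtain ⟨rfl, rfl⟩ := hpos h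
      exact ⟨.inr P, rfl⟩

end LinkDiagram

/-! ### Augmentations and Gaussian elimination -/

section Augmentations

variable {R : Type u} [CommRing R]

/-- A homomorphism that vanishes on the differentials of the Reeb chords vanishes on all
differentials, by the Leibniz rule. -/
lemma map_ceDiff_eq_zero {C T : Type} {D : Diagram C T} (ε : CEAlg C T →+* R)
    (h : ∀ c, ε (chordDiff D c) = 0) (x : CEAlg C T) : ε (ceDiff D x) = 0 := by
  induction x using MonoidAlgebra.induction_on with
  | of m =>
    have hmul : ∀ a b : CEWord C T, ε (ceDiff D (MonoidAlgebra.of (ZMod 2) _ a)) = 0 →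
        ε (ceDiff D (MonoidAlgebra.of (ZMod 2) _ b)) = 0 →
        ε (ceDiff D (MonoidAlgebra.of (ZMod 2) _ (a * b))) = 0 := fun a b ha hb => by
      rw [map_mul, ceDiff_mul, map_add, map_mul, map_mul, ha, hb, zero_mul, mul_zero, add_zero]
    induction m using Monoid.Coprod.induction_on with
    | inl m =>
      induction m using FreeMonoid.inductionOn with
      | one =>
        have := ceDiff_marks D 1
        rw [map_one] at this
        rw [map_one, this, map_zero]
      | of c => exact (congrArg ε (ceDiff_chord D c)).trans (h c)
      | mul a b ha hb => rw [map_mul]; exact hmul _ _ ha hb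
    | inr g => rw [ceDiff_marks, map_zero]
    | mul a b ha hb => exact hmul _ _ ha hb
  | add a b ha hb => rw [ceDiff_add, map_add, ha, hb, add_zero]
  | smul r a ha =>
    obtain rfl | rfl : r = 0 ∨ r = 1 := by
      revert r
      decide
    · rw [zero_smul, ceDiff, map_zero]
      exact map_zero ε
    · rwa [one_smul]

/-- The homomorphism with given values on the Reeb chords and the marked points. -/
noncomputable def ceEval {C T : Type} (ι : ZMod 2 →+* R) (b : C → R) (t : T → Rˣ) :
    CEAlg C T →+* R :=
  MonoidAlgebra.liftNCRingHom ι (Monoid.Coprod.lift (FreeMonoid.lift b)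
    ((Units.coeHom R).comp (FreeGroup.lift t))) fun _ _ => Commute.all _ _

lemma ceEval_of {C T : Type} (ι : ZMod 2 →+* R) (b : C → R) (t : T → Rˣ) (m : CEWord C T) :
    ceEval ι b t (MonoidAlgebra.of (ZMod 2) _ m) = Monoid.Coprod.lift (FreeMonoid.lift b)
      ((Units.coeHom R).comp (FreeGroup.lift t)) m := by
  rw [MonoidAlgebra.of_apply]
  exact (MonoidAlgebra.liftNC_single _ _ _ _).trans
    ((congrArg (· * _) (map_one ι)).trans (one_mul _))

variable {n : ℕ} {w : BraidWord n}

lemma Augmentation.map_mark_mul (h2 : (2 : R) = 0)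
    (ε : Augmentation (linkDiagram w) LinkChord.degree R) (k : Fin n) :
    ε.hom (MonoidAlgebra.of (ZMod 2) _ (markWord k)) *
      schur (entry (partialProd w (extendZero fun k =>
        ε.hom (MonoidAlgebra.of (ZMod 2) _ (chordWord (.braid k)))) w.length))
        (extendZero fun k => ε.hom (MonoidAlgebra.of (ZMod 2) _ (markWord k))) k k k = 1 := by
  have h := map_chordDiff_cusp w ε.hom h2 (fun k => ε.map_chord _ (by simp [LinkChord.degree])) k
  rw [← ceDiff_chord, ε.map_diff] at h
  have ht : ε.hom (MonoidAlgebra.of (ZMod 2) _ (markWord k)) *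
      ε.hom (MonoidAlgebra.of (ZMod 2) _ (Monoid.Coprod.inr (FreeGroup.of k)⁻¹)) = 1 := by
    rw [← map_mul, ← map_mul, markWord, ← map_mul, mul_inv_cancel, map_one, map_one, map_one]
  linear_combination (-ε.hom (MonoidAlgebra.of (ZMod 2) _ (markWord k))) * h - ht - h2

/-- The Reeb coordinates of an augmentation: the condition that the differentials of the cusps are
sent to zero says that Gaussian elimination succeeds, with the pivots `t_k⁻¹`. -/
noncomputable def Augmentation.toCell (h2 : (2 : R) = 0)
    (ε : Augmentation (linkDiagram w) LinkChord.degree R) : CoordCell w R where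
  coord k := ε.hom (MonoidAlgebra.of (ZMod 2) _ (chordWord (.braid k)))
  mem := inBigCell_of_pivots h2
    (t := extendZero fun k => ε.hom (MonoidAlgebra.of (ZMod 2) _ (markWord k))) fun k hk => by
      have h := ε.map_mark_mul h2 ⟨k, hk⟩
      rwa [← extendZero_val fun k => ε.hom (MonoidAlgebra.of (ZMod 2) _ (markWord k))] at h

/-- The values on the marked points are determined by the product of the matrices `R_{i_k}(b_k)`. -/
lemma Augmentation.map_mark_eq (h2 : (2 : R) = 0) {w' : BraidWord n}
    (ε : Augmentation (linkDiagram w) LinkChord.degree R)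
    (ε' : Augmentation (linkDiagram w') LinkChord.degree R)
    (h : partialProd w (extendZero (ε.toCell h2).coord) w.length =
      partialProd w' (extendZero (ε'.toCell h2).coord) w'.length) (k : Fin n) :
    ε.hom (MonoidAlgebra.of (ZMod 2) _ (markWord k)) =
      ε'.hom (MonoidAlgebra.of (ZMod 2) _ (markWord k)) := by
  simp only [Augmentation.toCell] at h
  have := pivot_unique (A := entry (partialProd w (extendZero fun k =>
        ε.hom (MonoidAlgebra.of (ZMod 2) _ (chordWord (.braid k)))) w.length))
    (t := extendZero fun k => ε.hom (MonoidAlgebra.of (ZMod 2) _ (markWord k)))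
    (t' := extendZero fun k => ε'.hom (MonoidAlgebra.of (ZMod 2) _ (markWord k))) n
    (fun k hk => by simpa only [extendZero, hk, dif_pos] using ε.map_mark_mul h2 ⟨k, hk⟩)
    (fun k hk => by
      rw [h]
      simpa only [extendZero, hk, dif_pos] using ε'.map_mark_mul h2 ⟨k, hk⟩) k k.2
  rwa [extendZero_val, extendZero_val] at this

lemma Augmentation.toCell_injective (h2 : (2 : R) = 0) :
    Function.Injective (Augmentation.toCell (w := w) h2) := by
  intro ε ε' h
  have ht := ε.map_mark_eq h2 ε' (by rw [h])
  refine Augmentation.ext (MonoidAlgebra.ringHom_ext' (Subsingleton.elim _ _) ?_)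
  refine Monoid.Coprod.hom_ext (FreeMonoid.hom_eq fun c => ?_) (FreeGroup.ext_hom _ _ fun t => ?_)
  · cases c with
    | braid k => exact congrFun (congrArg CoordCell.coord h) k
    | cusp k =>
      exact (ε.map_chord (.cusp k) (by simp [LinkChord.degree])).trans
        (ε'.map_chord (.cusp k) (by simp [LinkChord.degree])).symm
  · exact ht t

lemma Augmentation.toCell_surjective (ι : ZMod 2 →+* R) (h2 : (2 : R) = 0) :
    Function.Surjective (Augmentation.toCell (w := w) h2) := by
  intro q
  obtain ⟨t, ht⟩ := exists_pivots h2 q.mem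
  let u : Fin n → Rˣ := fun k => ⟨t k, _, ht k k.2, (mul_comm _ _).trans (ht k k.2)⟩
  let b : LinkChord w.length n → R := fun c => match c with
    | .braid k => q.coord k
    | .cusp _ => 0
  have hb : ∀ c, ceEval ι b u (MonoidAlgebra.of (ZMod 2) _ (chordWord c)) = b c := fun c => by
    rw [ceEval_of]; simp [chordWord]
  have hu : ∀ k, ceEval ι b u (MonoidAlgebra.of (ZMod 2) _ (markWord k)) = t k := fun k => by
    rw [ceEval_of]; simp [markWord, u]
  have hu' : ∀ k : Fin n, ceEval ι b u (MonoidAlgebra.of (ZMod 2) _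
      (Monoid.Coprod.inr (FreeGroup.of k)⁻¹)) =
        schur (entry (partialProd w (extendZero q.coord) w.length)) t k k k := fun k => by
    rw [ceEval_of]; simp [u]
  refine ⟨⟨ceEval ι b u, map_ceDiff_eq_zero _ fun c => ?_, fun c hc => ?_⟩,
    CoordCell.ext (funext fun k => hb (.braid k))⟩
  · cases c with
    | braid k => exact map_chordDiff_braid w _ h2 k
    | cusp k =>
      have e : schur (entry (partialProd w (extendZero q.coord) w.length))
          (extendZero fun k : Fin n => t k) k = schur (entry (partialProd w
            (extendZero q.coord) w.length)) t k :=
        schur_congr _ fun j hj => by simp [extendZero, hj.trans k.2]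
      rw [map_chordDiff_cusp w _ h2 (fun k => hb (.cusp k))]
      simp only [hb, hu, hu', b, e]
      linear_combination schur (entry (partialProd w (extendZero q.coord) w.length)) t k k k * h2
  · cases c with
    | braid k => simp [LinkChord.degree] at hc
    | cusp k => exact hb _

end Augmentations

/-! ### The isomorphisms -/

section Isomorphisms

variable (F : Type u) [Field F] [CharP F 2] {n : ℕ}

lemma two_eq_zero_of_algebra (R : Type u) [CommRing R] [Algebra F R] : (2 : R) = 0 := by
  have h := congrArg (algebraMap F R) (CharP.cast_eq_zero F 2)
  rwa [Nat.cast_ofNat, map_ofNat, map_zero] at h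

/-- The functor of points of the variety `CoordCell`. -/
def cellVariety (w : BraidWord n) : CommAlgCat.{u} F ⥤ Type u where
  obj R := CoordCell w R
  map f := TypeCat.ofHom (CoordCell.map (f.hom : _ →+* _))

/-- The Reeb coordinates of a point of the augmentation variety. -/
noncomputable def augToCell (w : BraidWord n) (R : CommAlgCat.{u} F) (ε : (augVariety F w).obj R) :
    CoordCell w R :=
  (Augmentation.ofPoint (CommAlgCat.Hom.hom ε : LinkAugRing F w →ₐ[F] R)).toCell
    (two_eq_zero_of_algebra F R)

/-- The augmentation variety in Reeb coordinates. -/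
noncomputable def augIsoCell (w : BraidWord n) : augVariety F w ≅ cellVariety F w :=
  NatIso.ofComponents (fun R => (Equiv.ofBijective (augToCell F w R) (by
    have h : Function.Bijective (Augmentation.toCell (w := w) (two_eq_zero_of_algebra F R)) :=
      ⟨Augmentation.toCell_injective _, Augmentation.toCell_surjective
        ((algebraMap F R).comp (ZMod.castHom (dvd_refl 2) F)) _⟩
    have h' : Function.Bijective (fun ε : (augVariety F w).obj R =>
        (CommAlgCat.Hom.hom ε : LinkAugRing F w →ₐ[F] R)) :=
      ⟨fun _ _ h => CommAlgCat.hom_ext h, fun f => ⟨CommAlgCat.ofHom f, rfl⟩⟩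
    exact h.comp (Augmentation.ofPoint_bijective.comp h'))).toIso) fun f => by
      ext ε
      rfl

/-- The double Bott–Samelson cell in affine coordinates. -/
noncomputable def cellIsoConf (w : BraidWord n) : cellVariety F w ≅ confVariety F w :=
  NatIso.ofComponents
    (fun R => (Equiv.ofBijective (CoordCell.toConf (w := w) (R := R))
      CoordCell.toConf_bijective).toIso) fun f => by
      ext q
      exact CoordCell.toConf_map _ q

/-- A braid move in coordinates. -/
noncomputable def BraidMove.cellIso {w w' : BraidWord n} (m : BraidMove w w') :
    cellVariety F w ≅ cellVariety F w' :=
  NatIso.ofComponents (fun R => (m.cellEquiv (two_eq_zero_of_algebra F R)).toIso) fun {R S} f => by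
      ext q
      exact m.cellMap_map _ (two_eq_zero_of_algebra F R) (two_eq_zero_of_algebra F S) q

/-- A sequence of braid moves in coordinates. -/
noncomputable def MovePath.cellIso {w w' : BraidWord n} :
    MovePath w w' → (cellVariety F w ≅ cellVariety F w')
  | .nil _ => Iso.refl _
  | .cons m p => m.cellIso F ≪≫ p.cellIso

variable {F}

lemma BraidMove.reebRel_iff {w w' : BraidWord n} (m : BraidMove w w') {R : CommAlgCat.{u} F}
    (ε : (augVariety F w).obj R) (ε' : (augVariety F w').obj R) :
    m.ReebRel ε ε' ↔
      m.cellMap (two_eq_zero_of_algebra F R) (augToCell F w R ε) = augToCell F w' R ε' := by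
  have h2 := two_eq_zero_of_algebra F R
  constructor
  · rintro ⟨h, -⟩
    exact CoordCell.ext (funext fun k => (h k).symm)
  · intro h
    refine ⟨fun k => (congrFun (congrArg CoordCell.coord h) k).symm, fun k => ?_⟩
    refine ((Augmentation.ofPoint (CommAlgCat.Hom.hom ε : LinkAugRing F w →ₐ[F] R)).map_mark_eq h2
      (Augmentation.ofPoint (CommAlgCat.Hom.hom ε' : LinkAugRing F w' →ₐ[F] R)) ?_ k).symm
    change partialProd w (extendZero (augToCell F w R ε).coord) _ =
      partialProd w' (extendZero (augToCell F w' R ε').coord) _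
    rw [← h, m.partialProd_reeb h2 _ m.not_inner_length, BraidMove.cellMap,
      m.reeb_eq_extendZero, ← m.length_eq]

lemma MovePath.reebRel_iff {w w' : BraidWord n} (p : MovePath w w') {R : CommAlgCat.{u} F}
    (ε : (augVariety F w).obj R) (ε' : (augVariety F w').obj R) :
    p.ReebRel ε ε' ↔ (p.cellIso F).hom.app R ((augIsoCell F w).hom.app R ε) =
      (augIsoCell F w').hom.app R ε' := by
  induction p with
  | nil w =>
    exact ((augIsoCell F w).app R).toEquiv.injective.eq_iff.symm
  | @cons w w₁ w' m p ih =>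
    have hs : Function.Surjective ((augIsoCell F w₁).hom.app R) :=
      ((augIsoCell F w₁).app R).toEquiv.surjective
    constructor
    · rintro ⟨ε₁, h1, h⟩
      refine Eq.trans ?_ ((ih ε₁ ε').1 h)
      exact congrArg ((p.cellIso F).hom.app R) ((m.reebRel_iff ε ε₁).1 h1)
    · intro h
      obtain ⟨ε₁, h1⟩ := hs ((m.cellIso F).hom.app R ((augIsoCell F w).hom.app R ε))
      refine ⟨ε₁, (m.reebRel_iff ε ε₁).2 h1.symm, (ih ε₁ ε').2 ?_⟩
      rw [h1]
      exact h

lemma MovePath.flagRel_iff {w w' : BraidWord n} (p : MovePath w w') {R : CommAlgCat.{u} F}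
    (q : (cellVariety F w).obj R) (q' : (cellVariety F w').obj R) :
    p.FlagRel (F := F) ((cellIsoConf F w).hom.app R q) ((cellIsoConf F w').hom.app R q') ↔
      (p.cellIso F).hom.app R q = q' := by
  induction p with
  | nil w =>
    exact ((cellIsoConf F w).app R).toEquiv.injective.eq_iff
  | @cons w w₁ w' m p ih =>
    have hm : ∀ c, m.FlagRel (F := F) ((cellIsoConf F w).hom.app R q) c ↔
        (cellIsoConf F w₁).hom.app R ((m.cellIso F).hom.app R q) = c := fun c =>
      m.flagRel_toConf_iff (two_eq_zero_of_algebra F R) q c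
    constructor
    · rintro ⟨c, h1, h⟩
      obtain rfl := (hm c).1 h1
      exact (ih _ q').1 h
    · intro h
      exact ⟨_, (hm _).2 rfl, (ih _ q').2 h⟩

end Isomorphisms

theorem theorem3p6 (F : Type u) [Field F] [IsAlgClosed F] [CharP F 2] (n : ℕ) (β : PosBraid n) :
    -- any two words of `β` are connected by braid moves
    (∀ w w' : β.Word, Nonempty (MovePath w.1 w'.1)) ∧
    -- natural isomorphisms `γ : Aug(Λ_β) ≅ Conf^e_β(C)` over `F`, one for each word of `β`,
    ∃ γ : ∀ w : β.Word, augVariety F w.1 ≅ confVariety F w.1,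
      -- which identify the Reeb coordinates with the affine coordinates,
      (∀ (w : β.Word) (R : CommAlgCat.{u} F) (ε : (augVariety F w.1).obj R)
        (q : Fin w.1.length → R),
        Conf.HasCoords ((γ w).hom.app R ε) q ↔
          ∀ k, CommAlgCat.Hom.hom ε (reebCoord F w.1 k) = q k) ∧
      -- and which are compatible with the canonical isomorphisms between the augmentation
      -- varieties, and between the double Bott-Samelson cells, of different words of `β`
      ∀ (w w' : β.Word) (p : MovePath w.1 w'.1),
        ∃ (φ : augVariety F w.1 ≅ augVariety F w'.1) (ψ : confVariety F w.1 ≅ confVariety F w'.1),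
          (∀ (R : CommAlgCat.{u} F) (ε : (augVariety F w.1).obj R)
            (ε' : (augVariety F w'.1).obj R), φ.hom.app R ε = ε' ↔ p.ReebRel ε ε') ∧
          (∀ (R : CommAlgCat.{u} F) (c : (confVariety F w.1).obj R)
            (c' : (confVariety F w'.1).obj R), ψ.hom.app R c = c' ↔ p.FlagRel c c') ∧
          φ.hom ≫ (γ w').hom = (γ w).hom ≫ ψ.hom := by 
  refine ⟨nonempty_movePath, fun w => augIsoCell F w.1 ≪≫ cellIsoConf F w.1, fun w R ε q => ?_,
    fun w w' p => ?_⟩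
  · refine (CoordCell.hasCoords_toConf_iff (augToCell F w.1 R ε) q).trans ?_
    exact funext_iff
  · refine ⟨augIsoCell F w.1 ≪≫ p.cellIso F ≪≫ (augIsoCell F w'.1).symm,
      (cellIsoConf F w.1).symm ≪≫ p.cellIso F ≪≫ cellIsoConf F w'.1, fun R ε ε' => ?_,
      fun R c c' => ?_, by simp⟩
    · rw [p.reebRel_iff]
      exact ((augIsoCell F w'.1).app R).toEquiv.symm_apply_eq
    · obtain ⟨q, rfl⟩ := ((cellIsoConf F w.1).app R).toEquiv.surjective c
      obtain ⟨q', rfl⟩ := ((cellIsoConf F w'.1).app R).toEquiv.surjective c'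
      refine Iff.trans ?_ (p.flagRel_iff q q').symm
      refine Iff.trans ?_ ((cellIsoConf F w'.1).app R).toEquiv.injective.eq_iff
      have e : ((cellIsoConf F w.1).symm ≪≫ p.cellIso F ≪≫ cellIsoConf F w'.1).hom.app R
          (((cellIsoConf F w.1).app R).toEquiv q) =
          ((cellIsoConf F w'.1).app R).toEquiv ((p.cellIso F).hom.app R q) := by
        simp
      rw [e]
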